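/- \textbf{Conventions.} All C*-algebras are unital and all morphisms are unital $*$-homomorphisms; $\otimes$ denotes the spatial (minimal) tensor product of C*-algebras. A \emph{state} of a C*-algebra $C$ is a positive linear functional $\nu:C\to\mathbb{C}$ with $\nu(1)=1$; write $\mathrm{id}\otimes\nu:A\otimes C\to A$ for the slice map, i.e. the bounded linear map with $a\otimes c\mapsto\nu(c)a$. A \emph{noncommutative Feller--Markov operator} (NFMO) from $B$ to $A$ is a unit-preserving completely positive linear map $\mathcal{F}:B\to A$. A \emph{random quantum map} from $B$ to $A$ is a triple $(C,\phi,\nu)$, where $C$ is a C*-algebra, $\phi:B\to A\otimes C$ is a morphism, and $\nu$ is a state of $C$. An NFMO $\mathcal{F}:B\to A$ is \emph{implemented} if there is a random quantum map $(C,\phi,\nu)$ from $B$ to $A$ with $\mathcal{F}(b)=(\mathrm{id}\otimes\nu)(\phi(b))$ for all $b\in B$. \textbf{Theorem.} \begin{enumerate} \item[(i)] Every state $\sigma:A\to\mathbb{C}$ of a C*-algebra $A$, and every morphism $\phi:B\to A$ between C*-algebras, is an implemented NFMO. \item[(ii)] If $\mathcal{F}_1:A_2\to A_1$ and $\mathcal{F}_2:A_3\to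 A_2$ are implemented NFMOs, then the composition $\mathcal{F}_1\mathcal{F}_2:A_3\to A_1$ is an implemented NFMO. If $\mathcal{F}_1:B_1\to A_1$ and $\mathcal{F}_2:B_2\to A_2$ are implemented NFMOs, then the direct sum $\mathcal{F}_1\oplus\mathcal{F}_2:B_1\oplus B_2\to A_1\oplus A_2$, $(b_1,b_2)\mapsto(\mathcal{F}_1(b_1),\mathcal{F}_2(b_2))$, is an implemented NFMO; moreover there is a unique bounded linear map $\mathcal{F}_1\otimes\mathcal{F}_2:B_1\otimes B_2\to A_1\otimes A_2$ with $b_1\otimes b_2\mapsto\mathcal{F}_1(b_1)\otimes\mathcal{F}_2(b_2)$, and it is an implemented NFMO. \end{enumerate} -/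

import Mathlib

universe u u₁ u₂ u₃ u₄ w w₁ w₂

open scoped TensorProduct ComplexOrder ENNReal InnerProductSpace CStarAlgebra

noncomputable section

namespace QuantumMaps

/-- A state of a unital C⋆-algebra: a positive linear functional with value `1` at `1`. -/
abbrev State (A : Type*) [CStarAlgebra A] [PartialOrder A] [StarOrderedRing A] : Type _ :=
  {f : A →ₚ[ℂ] ℂ // f 1 = 1}

section UniversalRepresentation

variable (A : Type*) [CStarAlgebra A] [PartialOrder A] [StarOrderedRing A]

/-- The Hilbert space of the universal representation of `A`: the `ℓ²`-direct sum of the GNS spaces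
of all states of `A`. -/
def UnivSpace : Type _ := lp (fun f : State A => f.1.GNS) 2

instance : NormedAddCommGroup (UnivSpace A) :=
  inferInstanceAs (NormedAddCommGroup (lp (fun f : State A => f.1.GNS) 2))

instance : InnerProductSpace ℂ (UnivSpace A) :=
  inferInstanceAs (InnerProductSpace ℂ (lp (fun f : State A => f.1.GNS) 2))

instance : CompleteSpace (UnivSpace A) :=
  inferInstanceAs (CompleteSpace (lp (fun f : State A => f.1.GNS) 2))

/-- The operator on the direct sum which acts as the GNS operator of `a` in each summand. -/
def univRepAux (a : A) : lp (fun f : State A => f.1.GNS) 2 →L[ℂ] lp (fun f : State A => f.1.GNS) 2 :=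
  lp.mapCLM 2 (fun f : State A => f.1.gnsStarAlgHom a) (norm_nonneg a)
    (fun f => NonUnitalStarAlgHom.norm_apply_le f.1.gnsStarAlgHom a)

/-- The universal representation of `A`, the direct sum of the GNS representations of all states. -/
def univRep : A →⋆ₐ[ℂ] (UnivSpace A →L[ℂ] UnivSpace A) where
  toFun a := univRepAux A a
  map_one' := by
    change univRepAux A 1 = 1
    ext x f; simp [univRepAux]
  map_mul' a b := by
    change univRepAux A (a * b) = univRepAux A a * univRepAux A b
    ext x f; simp [univRepAux]
  map_zero' := by
    change univRepAux A 0 = 0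
    ext x f; simp [univRepAux]
  map_add' a b := by
    change univRepAux A (a + b) = univRepAux A a + univRepAux A b
    ext x f; simp [univRepAux]
  commutes' r := by
    change univRepAux A (algebraMap ℂ A r) = algebraMap ℂ _ r
    ext x f; simp [univRepAux, Algebra.algebraMap_eq_smul_one]
  map_star' a := by
    change univRepAux A (star a) = star (univRepAux A a)
    refine (ContinuousLinearMap.eq_adjoint_iff _ _).mpr fun x y => ?_
    simp only [lp.inner_eq_tsum]
    refine tsum_congr fun f => ?_
    change ⟪(f.1.gnsStarAlgHom (star a)) (x f), y f⟫_ℂ = ⟪x f, (f.1.gnsStarAlgHom a) (y f)⟫_ℂ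
    rw [map_star, ContinuousLinearMap.star_eq_adjoint, ContinuousLinearMap.adjoint_inner_left]

end UniversalRepresentation

section Hilbert

variable (H K : Type*) [NormedAddCommGroup H] [InnerProductSpace ℂ H]
  [NormedAddCommGroup K] [InnerProductSpace ℂ K]

/-- The Hilbert space tensor product: the completion of the algebraic tensor product for the inner
product `⟪x ⊗ y, x' ⊗ y'⟫ = ⟪x, x'⟫ * ⟪y, y'⟫`. -/
def HilbertTensor : Type _ := UniformSpace.Completion (H ⊗[ℂ] K)

instance : NormedAddCommGroup (HilbertTensor H K) :=
  inferInstanceAs (NormedAddCommGroup (UniformSpace.Completion (H ⊗[ℂ] K)))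

instance : InnerProductSpace ℂ (HilbertTensor H K) :=
  inferInstanceAs (InnerProductSpace ℂ (UniformSpace.Completion (H ⊗[ℂ] K)))

instance : CompleteSpace (HilbertTensor H K) :=
  inferInstanceAs (CompleteSpace (UniformSpace.Completion (H ⊗[ℂ] K)))

/-- The embedding of the algebraic tensor product in the Hilbert space tensor product. -/
def toHilbertTensor : H ⊗[ℂ] K →ₗᵢ[ℂ] HilbertTensor H K :=
  (UniformSpace.Completion.toComplₗᵢ : H ⊗[ℂ] K →ₗᵢ[ℂ] UniformSpace.Completion (H ⊗[ℂ] K))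

theorem denseRange_toHilbertTensor : DenseRange (toHilbertTensor H K) :=
  UniformSpace.Completion.denseRange_coe

variable {H K}

/-- The operator `S ⊗ T` on the Hilbert space tensor product. -/
def opTensor (S : H →L[ℂ] H) (T : K →L[ℂ] K) : HilbertTensor H K →L[ℂ] HilbertTensor H K :=
  (TensorProduct.mapL S T).completion

theorem opTensor_tmul (S : H →L[ℂ] H) (T : K →L[ℂ] K) (x : H) (y : K) :
    opTensor S T (toHilbertTensor H K (x ⊗ₜ[ℂ] y)) = toHilbertTensor H K (S x ⊗ₜ[ℂ] T y) :=
  ContinuousLinearMap.completion_apply_coe (TensorProduct.mapL S T) (x ⊗ₜ[ℂ] y)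

theorem hilbertTensor_clm_ext {E : Type*} [NormedAddCommGroup E] [NormedSpace ℂ E]
    {S T : HilbertTensor H K →L[ℂ] E}
    (h : ∀ x y, S (toHilbertTensor H K (x ⊗ₜ[ℂ] y)) = T (toHilbertTensor H K (x ⊗ₜ[ℂ] y))) :
    S = T := by
  ext z
  refine (denseRange_toHilbertTensor H K).induction_on z
    (isClosed_eq S.continuous T.continuous) fun z => ?_
  induction z with
  | zero => simp only [map_zero]
  | tmul x y => exact h x y
  | add x y hx hy => simp only [map_add, hx, hy]

theorem opTensor_mul (S S' : H →L[ℂ] H) (T T' : K →L[ℂ] K) :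
    opTensor (S * S') (T * T') = opTensor S T * opTensor S' T' :=
  hilbertTensor_clm_ext fun x y => by
    simp only [opTensor_tmul, mul_apply_eq_comp]

theorem opTensor_one : opTensor (1 : H →L[ℂ] H) (1 : K →L[ℂ] K) = 1 :=
  hilbertTensor_clm_ext fun x y => by
    simp only [opTensor_tmul, one_apply_eq_self]

theorem inner_toHilbertTensor_tmul (x x' : H) (y y' : K) :
    ⟪toHilbertTensor H K (x ⊗ₜ[ℂ] y), toHilbertTensor H K (x' ⊗ₜ[ℂ] y')⟫_ℂ =
      ⟪x, x'⟫_ℂ * ⟪y, y'⟫_ℂ := by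
  rw [LinearIsometry.inner_map_map, TensorProduct.inner_tmul]

theorem opTensor_star [CompleteSpace H] [CompleteSpace K] (S : H →L[ℂ] H) (T : K →L[ℂ] K) :
    opTensor (star S) (star T) = star (opTensor S T) := by
  refine (ContinuousLinearMap.eq_adjoint_iff _ _).mpr fun x y => ?_
  refine (denseRange_toHilbertTensor H K).induction_on₂ ?_ ?_ x y
  · apply isClosed_eq <;> fun_prop
  · intro x y
    induction x with
    | zero => simp only [map_zero, inner_zero_left]
    | add x x' hx hx' => simp only [map_add, inner_add_left, hx, hx']
    | tmul a b =>
      induction y with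
      | zero => simp only [map_zero, inner_zero_right]
      | add y y' hy hy' => simp only [map_add, inner_add_right, hy, hy']
      | tmul c d =>
        simp only [opTensor_tmul, inner_toHilbertTensor_tmul,
          ContinuousLinearMap.star_eq_adjoint, ContinuousLinearMap.adjoint_inner_left]

/-- The map `(S, T) ↦ S ⊗ T` as a bilinear map. -/
def opTensorLinear : (H →L[ℂ] H) →ₗ[ℂ] (K →L[ℂ] K) →ₗ[ℂ]
    (HilbertTensor H K →L[ℂ] HilbertTensor H K) :=
  LinearMap.mk₂ ℂ opTensor
    (fun _ _ _ => hilbertTensor_clm_ext fun x y => by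
      simp only [opTensor_tmul, add_apply, TensorProduct.add_tmul, map_add])
    (fun _ _ _ => hilbertTensor_clm_ext fun x y => by
      simp only [opTensor_tmul, smul_apply, ← TensorProduct.smul_tmul',
        map_smul])
    (fun _ _ _ => hilbertTensor_clm_ext fun x y => by
      simp only [opTensor_tmul, add_apply, TensorProduct.tmul_add, map_add])
    (fun _ _ _ => hilbertTensor_clm_ext fun x y => by
      simp only [opTensor_tmul, smul_apply, TensorProduct.tmul_smul,
        map_smul])

end Hilbert

section TensorRep
variable {A C H K : Type*} [CStarAlgebra A] [CStarAlgebra C]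
  [NormedAddCommGroup H] [InnerProductSpace ℂ H] [CompleteSpace H]
  [NormedAddCommGroup K] [InnerProductSpace ℂ K] [CompleteSpace K]

/-- The linear map `a ⊗ c ↦ ρ a ⊗ σ c` on the algebraic tensor product. -/
def tensorRepLinear (ρ : A →⋆ₐ[ℂ] (H →L[ℂ] H)) (σ : C →⋆ₐ[ℂ] (K →L[ℂ] K)) :
    A ⊗[ℂ] C →ₗ[ℂ] (HilbertTensor H K →L[ℂ] HilbertTensor H K) :=
  TensorProduct.lift (opTensorLinear.compl₁₂ (ρ : A →ₗ[ℂ] (H →L[ℂ] H)) (σ : C →ₗ[ℂ] (K →L[ℂ] K)))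

theorem tensorRepLinear_tmul (ρ : A →⋆ₐ[ℂ] (H →L[ℂ] H)) (σ : C →⋆ₐ[ℂ] (K →L[ℂ] K))
    (a : A) (c : C) : tensorRepLinear ρ σ (a ⊗ₜ[ℂ] c) = opTensor (ρ a) (σ c) := rfl

theorem tensorRepLinear_one (ρ : A →⋆ₐ[ℂ] (H →L[ℂ] H)) (σ : C →⋆ₐ[ℂ] (K →L[ℂ] K)) :
    tensorRepLinear ρ σ 1 = 1 := by
  rw [Algebra.TensorProduct.one_def, tensorRepLinear_tmul, map_one, map_one, opTensor_one]

theorem tensorRepLinear_mul (ρ : A →⋆ₐ[ℂ] (H →L[ℂ] H)) (σ : C →⋆ₐ[ℂ] (K →L[ℂ] K))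
    (x y : A ⊗[ℂ] C) :
    tensorRepLinear ρ σ (x * y) = tensorRepLinear ρ σ x * tensorRepLinear ρ σ y := by
  induction x with
  | zero => rw [zero_mul, map_zero, zero_mul]
  | add x x' hx hx' => rw [add_mul, map_add, map_add, add_mul, hx, hx']
  | tmul a c =>
    induction y with
    | zero => rw [mul_zero, map_zero, mul_zero]
    | add y y' hy hy' => rw [mul_add, map_add, map_add, mul_add, hy, hy']
    | tmul a' c' =>
      rw [Algebra.TensorProduct.tmul_mul_tmul]
      simp only [tensorRepLinear_tmul, map_mul, opTensor_mul]

theorem tensorRepLinear_star (ρ : A →⋆ₐ[ℂ] (H →L[ℂ] H)) (σ : C →⋆ₐ[ℂ] (K →L[ℂ] K))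
    (x : A ⊗[ℂ] C) : tensorRepLinear ρ σ (star x) = star (tensorRepLinear ρ σ x) := by
  induction x with
  | zero => rw [star_zero, map_zero, star_zero]
  | add x y hx hy => rw [star_add, map_add, map_add, star_add, hx, hy]
  | tmul a c =>
    rw [TensorProduct.star_tmul]
    simp only [tensorRepLinear_tmul, map_star, opTensor_star]

/-- The representation `ρ ⊗ σ` of the algebraic tensor product on the Hilbert space tensor product,
`a ⊗ c ↦ ρ a ⊗ σ c`. -/
def tensorRep (ρ : A →⋆ₐ[ℂ] (H →L[ℂ] H)) (σ : C →⋆ₐ[ℂ] (K →L[ℂ] K)) :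
    A ⊗[ℂ] C →⋆ₐ[ℂ] (HilbertTensor H K →L[ℂ] HilbertTensor H K) where
  __ := AlgHom.ofLinearMap (tensorRepLinear ρ σ) (tensorRepLinear_one ρ σ)
    (tensorRepLinear_mul ρ σ)
  map_star' := tensorRepLinear_star ρ σ

theorem tensorRep_tmul (ρ : A →⋆ₐ[ℂ] (H →L[ℂ] H)) (σ : C →⋆ₐ[ℂ] (K →L[ℂ] K)) (a : A) (c : C) :
    tensorRep ρ σ (a ⊗ₜ[ℂ] c) = opTensor (ρ a) (σ c) := rfl

end TensorRep

section SpatialTensor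
variable (A C : Type*) [CStarAlgebra A] [PartialOrder A] [StarOrderedRing A]
  [CStarAlgebra C] [PartialOrder C] [StarOrderedRing C]

/-- The spatial (minimal) tensor product of unital C⋆-algebras `A` and `C`: the norm closure of the
image of the algebraic tensor product under `π_A ⊗ π_C`, where `π_A` and `π_C` are the universal
representations (which are faithful, see `univRep_injective`). -/
def SpatialTensor : Type _ :=
  ((tensorRep (univRep A) (univRep C)).range.topologicalClosure :
    StarSubalgebra ℂ (HilbertTensor (UnivSpace A) (UnivSpace C) →L[ℂ]
      HilbertTensor (UnivSpace A) (UnivSpace C)))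

instance : CStarAlgebra (SpatialTensor A C) :=
  StarSubalgebra.cstarAlgebra
    ((tensorRep (univRep A) (univRep C)).range.topologicalClosure)
    (h_closed := StarSubalgebra.isClosed_topologicalClosure _)

/-- The usual order of a C⋆-algebra. -/
instance : PartialOrder (SpatialTensor A C) := CStarAlgebra.spectralOrder _

instance : StarOrderedRing (SpatialTensor A C) := CStarAlgebra.spectralOrderedRing _

/-- The canonical ⋆-homomorphism of the algebraic into the spatial tensor product. -/
def algToSpatial : A ⊗[ℂ] C →⋆ₐ[ℂ] SpatialTensor A C :=
  (StarSubalgebra.inclusion (StarSubalgebra.le_topologicalClosure _)).comp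
    (tensorRep (univRep A) (univRep C)).rangeRestrict

end SpatialTensor

section States

variable {A : Type*} [CStarAlgebra A] [PartialOrder A] [StarOrderedRing A]

theorem dual_im_eq_zero (g : StrongDual ℂ A) (hg : ‖g‖ ≤ 1) (hg1 : g 1 = 1) {b : A}
    (hb : IsSelfAdjoint b) : (g b).im = 0 := by
  have key : ∀ t : ℝ, ((g b).im + t) ^ 2 ≤ ‖b‖ ^ 2 + t ^ 2 := by
    intro t
    have h0 : (1 : ℂ) = g 1 := hg1.symm
    have hA : Nontrivial A := by
      refine ⟨⟨1, 0, fun h => ?_⟩⟩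
      rw [h, map_zero] at hg1
      exact zero_ne_one hg1
    set z : A := b + ((t : ℂ) * Complex.I) • (1 : A) with hz
    have h1 : g z = g b + (t : ℂ) * Complex.I := by
      rw [hz, map_add, map_smul, hg1, smul_eq_mul, mul_one]
    have h2 : ‖g z‖ ≤ ‖z‖ := by
      calc ‖g z‖ ≤ ‖g‖ * ‖z‖ := g.le_opNorm z
        _ ≤ 1 * ‖z‖ := by gcongr
        _ = ‖z‖ := one_mul _
    have h3 : star z * z = b * b + ((t : ℂ) ^ 2) • (1 : A) := by
      rw [hz, star_add, star_smul, hb.star_eq, star_one]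
      simp only [RCLike.star_def, map_mul, Complex.conj_ofReal, Complex.conj_I, add_mul, mul_add,
        smul_mul_assoc, mul_smul_comm, one_mul, mul_one]
      have : (t : ℂ) * -Complex.I * (↑t * Complex.I) = (t : ℂ) ^ 2 := by
        ring_nf; rw [Complex.I_sq]; ring
      simp only [smul_add, smul_smul]
      rw [mul_comm ((t : ℂ) * Complex.I) ((t : ℂ) * -Complex.I), this]
      have h4 : ((t : ℂ) * -Complex.I) • b = -(((t : ℂ) * Complex.I) • b) := by
        rw [← neg_smul]; congr 1; ring
      rw [h4]
      abel
    have h4 : ‖z‖ ^ 2 ≤ ‖b‖ ^ 2 + t ^ 2 := by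
      rw [sq, ← CStarRing.norm_star_mul_self, h3]
      refine (norm_add_le _ _).trans ?_
      rw [norm_smul, CStarRing.norm_one, mul_one]
      gcongr
      · rw [sq]; exact norm_mul_le _ _
      · simp
    have h5 : ((g b).im + t) ^ 2 ≤ ‖g z‖ ^ 2 := by
      rw [h1, ← Complex.normSq_eq_norm_sq, Complex.normSq_apply]
      simp
      nlinarith [mul_self_nonneg (g b).re]
    exact h5.trans ((pow_le_pow_left₀ (norm_nonneg _) h2 2).trans h4)
  by_contra h
  have := key ((‖b‖ ^ 2 + 1) / (2 * (g b).im))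
  have h2 : 2 * (g b).im * ((‖b‖ ^ 2 + 1) / (2 * (g b).im)) = ‖b‖ ^ 2 + 1 := by
    field_simp
  nlinarith [sq_nonneg (g b).im]

theorem dual_nonneg (g : StrongDual ℂ A) (hg : ‖g‖ ≤ 1) (hg1 : g 1 = 1) {b : A}
    (hb : 0 ≤ b) : 0 ≤ g b := by
  have him := dual_im_eq_zero g hg hg1 (IsSelfAdjoint.of_nonneg hb)
  have h1 : ‖algebraMap ℝ A ‖b‖ - b‖ ≤ ‖b‖ := by
    have h2 : algebraMap ℝ A ‖b‖ - b ≤ algebraMap ℝ A ‖b‖ := sub_le_self _ hb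
    have h3 : 0 ≤ algebraMap ℝ A ‖b‖ - b :=
      sub_nonneg.mpr (IsSelfAdjoint.le_algebraMap_norm_self (.of_nonneg hb))
    refine (CStarAlgebra.norm_le_norm_of_nonneg_of_le h3 h2).trans ?_
    have hA : Nontrivial A := by
      refine ⟨⟨1, 0, fun h => ?_⟩⟩
      rw [h, map_zero] at hg1
      exact zero_ne_one hg1
    rw [norm_algebraMap', Real.norm_eq_abs, abs_norm]
  have h2 : g (algebraMap ℝ A ‖b‖ - b) = (‖b‖ : ℂ) - g b := by
    rw [map_sub, Algebra.algebraMap_eq_smul_one, ← Complex.coe_smul, map_smul, hg1, smul_eq_mul,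
      mul_one]
  have h3 : ‖(‖b‖ : ℂ) - g b‖ ≤ ‖b‖ := by
    rw [← h2]
    calc _ ≤ ‖g‖ * ‖algebraMap ℝ A ‖b‖ - b‖ := g.le_opNorm _
      _ ≤ 1 * ‖b‖ := by gcongr
      _ = ‖b‖ := one_mul _
  have h4 : ‖b‖ - (g b).re ≤ ‖b‖ := by
    have := (Complex.re_le_norm _).trans h3
    simpa using this
  rw [Complex.nonneg_iff]
  exact ⟨by linarith, him.symm⟩

theorem exists_state_apply_eq_norm [Nontrivial A] {a : A} (ha : 0 ≤ a) :
    ∃ f : State A, f.1 a = (‖a‖ : ℂ) := by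
  have hn : ‖1 + a‖ = 1 + ‖a‖ := by
    refine le_antisymm ((norm_add_le _ _).trans (by rw [CStarRing.norm_one])) ?_
    have h := CStarAlgebra.norm_mem_spectrum_of_nonneg ha
    have h2 : 1 + ‖a‖ ∈ spectrum ℝ (1 + a) := by
      have := (spectrum.add_mem_add_iff (s := (1 : ℝ)) (r := ‖a‖) (a := a)).mpr h
      simpa [add_comm] using this
    have := spectrum.norm_le_norm_of_mem h2
    rwa [Real.norm_of_nonneg (by positivity)] at this
  obtain ⟨g, hg, hga⟩ := exists_dual_vector ℂ (1 + a) (by rw [hn]; positivity)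
  have h1 : ‖g 1‖ ≤ 1 := by
    simpa [hg, CStarRing.norm_one] using g.le_opNorm 1
  have h2 : ‖g a‖ ≤ ‖a‖ := by simpa [hg] using g.le_opNorm a
  have h3 : g 1 + g a = 1 + (‖a‖ : ℂ) := by
    rw [← map_add, hga, hn]; simp
  have hre : (g 1).re + (g a).re = 1 + ‖a‖ := by simpa using congrArg Complex.re h3
  have hr1 : (g 1).re = 1 := by
    linarith [Complex.re_le_norm (g 1), Complex.re_le_norm (g a)]
  have hi1 : (g 1).im = 0 := by
    have h4 : ‖g 1‖ ^ 2 ≤ 1 := by nlinarith [norm_nonneg (g 1)]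
    rw [← Complex.normSq_eq_norm_sq, Complex.normSq_apply, hr1] at h4
    nlinarith
  have hg1 : g 1 = 1 := Complex.ext (by simpa using hr1) (by simpa using hi1)
  refine ⟨⟨PositiveLinearMap.mk₀ (g : A →ₗ[ℂ] ℂ) fun b hb => dual_nonneg g hg.le hg1 hb, hg1⟩, ?_⟩
  change g a = _
  rw [hg1] at h3
  exact add_left_cancel h3

open scoped Classical in
/-- The GNS cyclic vector of a state, as a vector in the universal representation space. -/
def cyclicVector (f : State A) : UnivSpace A :=
  (lp.single 2 f ((f.1.toPreGNS 1 : f.1.PreGNS) : f.1.GNS) : lp (fun f : State A => f.1.GNS) 2)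

theorem inner_cyclicVector (f : State A) (a : A) :
    ⟪cyclicVector f, univRep A a (cyclicVector f)⟫_ℂ = f.1 a := by
  classical
  refine (lp.inner_single_left (𝕜 := ℂ) (G := fun f : State A => f.1.GNS) f _ _).trans ?_
  change ⟪_, f.1.gnsStarAlgHom a ((lp.single 2 f _ : lp (fun f : State A => f.1.GNS) 2) f)⟫_ℂ = _
  rw [lp.single_apply_self]
  simp [PositiveLinearMap.preGNS_inner_def]

theorem norm_cyclicVector (f : State A) : ‖cyclicVector f‖ = 1 := by
  have h := inner_cyclicVector f 1
  rw [map_one, one_apply_eq_self, f.2, inner_self_eq_norm_sq_to_K] at h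
  have h2 : ‖cyclicVector f‖ ^ 2 = 1 := Complex.ofReal_injective (by simpa using h)
  nlinarith [norm_nonneg (cyclicVector f)]

theorem univRep_injective : Function.Injective (univRep A) := by
  rw [injective_iff_map_eq_zero]
  intro a ha
  by_contra h
  have hA : Nontrivial A := ⟨⟨a, 0, h⟩⟩
  obtain ⟨f, hf⟩ := exists_state_apply_eq_norm (star_mul_self_nonneg a)
  rw [← inner_cyclicVector, map_mul, ha, mul_zero, zero_apply, inner_zero_right,
    CStarRing.norm_star_mul_self] at hf
  exact h (by simpa using hf.symm)

theorem norm_univRep (a : A) : ‖univRep A a‖ = ‖a‖ :=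
  NonUnitalStarAlgHom.norm_map (univRep A) univRep_injective a

end States

section Slice

variable {H K : Type*} [NormedAddCommGroup H] [InnerProductSpace ℂ H]
  [NormedAddCommGroup K] [InnerProductSpace ℂ K]

/-- The map `x ↦ x ⊗ η`. -/
def tensorRight (η : K) : H →L[ℂ] HilbertTensor H K :=
  (toHilbertTensor H K).toContinuousLinearMap ∘L (TensorProduct.mkL ℂ H K).flip η

theorem tensorRight_apply (η : K) (x : H) :
    tensorRight η x = toHilbertTensor H K (x ⊗ₜ[ℂ] η) := rfl

theorem norm_tensorRight_le (η : K) (hη : ‖η‖ = 1) :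
    ‖(tensorRight η : H →L[ℂ] HilbertTensor H K)‖ ≤ 1 :=
  ContinuousLinearMap.opNorm_le_bound _ zero_le_one fun x => by
    rw [tensorRight_apply, LinearIsometry.norm_map, TensorProduct.norm_tmul, hη, mul_one, one_mul]

variable [CompleteSpace H]

/-- The compression `S ↦ V⋆ S V` along `V x = x ⊗ η`. -/
def compressRight (η : K) :
    (HilbertTensor H K →L[ℂ] HilbertTensor H K) →ₗ[ℂ] (H →L[ℂ] H) where
  toFun S := ContinuousLinearMap.adjoint (tensorRight η) ∘L S ∘L tensorRight η
  map_add' S T := by ext x; simp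
  map_smul' r S := by ext x; simp

theorem inner_compressRight (η : K) (S : HilbertTensor H K →L[ℂ] HilbertTensor H K) (x y : H) :
    ⟪x, compressRight η S y⟫_ℂ =
      ⟪toHilbertTensor H K (x ⊗ₜ[ℂ] η), S (toHilbertTensor H K (y ⊗ₜ[ℂ] η))⟫_ℂ :=
  ContinuousLinearMap.adjoint_inner_right (tensorRight η) x (S (tensorRight η y))

theorem compressRight_opTensor (η : K) (S : H →L[ℂ] H) (T : K →L[ℂ] K) :
    compressRight η (opTensor S T) = ⟪η, T η⟫_ℂ • S := by
  ext y
  refine ext_inner_left ℂ fun x => ?_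
  rw [inner_compressRight, opTensor_tmul, inner_toHilbertTensor_tmul, smul_apply, inner_smul_right,
    mul_comm]

theorem norm_compressRight_le (η : K) (hη : ‖η‖ = 1)
    (S : HilbertTensor H K →L[ℂ] HilbertTensor H K) : ‖compressRight η S‖ ≤ ‖S‖ := by
  have hV := norm_tensorRight_le (H := H) η hη
  have hV' : ‖ContinuousLinearMap.adjoint (tensorRight η : H →L[ℂ] HilbertTensor H K)‖ ≤ 1 := by
    rwa [LinearIsometryEquiv.norm_map]
  calc ‖compressRight η S‖
      ≤ ‖ContinuousLinearMap.adjoint (tensorRight η : H →L[ℂ] HilbertTensor H K)‖ *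
          (‖S‖ * ‖(tensorRight η : H →L[ℂ] HilbertTensor H K)‖) :=
        (ContinuousLinearMap.opNorm_comp_le _ _).trans
          (mul_le_mul_of_nonneg_left (ContinuousLinearMap.opNorm_comp_le _ _) (norm_nonneg _))
    _ ≤ 1 * (‖S‖ * 1) := by gcongr
    _ = ‖S‖ := by ring

end Slice

section SliceMap

variable (A : Type*) {C : Type*} [CStarAlgebra A] [PartialOrder A] [StarOrderedRing A]
  [CStarAlgebra C] [PartialOrder C] [StarOrderedRing C]

/-- The map `id ⊗ ν : a ⊗ c ↦ ν c • a` on the algebraic tensor product. -/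
def algSlice (ν : State C) : A ⊗[ℂ] C →ₗ[ℂ] A :=
  (TensorProduct.rid ℂ A : A ⊗[ℂ] ℂ →ₗ[ℂ] A) ∘ₗ (ν.1 : C →ₗ[ℂ] ℂ).lTensor A

theorem algSlice_tmul (ν : State C) (a : A) (c : C) : algSlice A ν (a ⊗ₜ[ℂ] c) = ν.1 c • a := by
  simp [algSlice]

/-- `algToSpatial` as a linear map. -/
def algToSpatialLinear (C : Type*) [CStarAlgebra C] [PartialOrder C] [StarOrderedRing C] :
    A ⊗[ℂ] C →ₗ[ℂ] SpatialTensor A C :=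
  (algToSpatial A C).toAlgHom.toLinearMap

/-- The slice map `id ⊗ ν : A ⊗ C → A` on the spatial tensor product: the continuous extension of
`algSlice`, which is contractive for the spatial norm (`norm_algSlice_le`). Its values are given by
`slice_algToSpatial`. -/
def slice (ν : State C) : SpatialTensor A C →L[ℂ] A :=
  (algSlice A ν).extendOfNorm (algToSpatialLinear A C)

theorem univRep_algSlice (ν : State C) (x : A ⊗[ℂ] C) :
    univRep A (algSlice A ν x) =
      compressRight (cyclicVector ν) (tensorRep (univRep A) (univRep C) x) := by
  induction x with
  | zero => simp only [map_zero]
  | add x y hx hy => simp only [map_add, hx, hy]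
  | tmul a c =>
    rw [algSlice_tmul, tensorRep_tmul, compressRight_opTensor, inner_cyclicVector, map_smul]

theorem norm_algSlice_le (ν : State C) (x : A ⊗[ℂ] C) :
    ‖algSlice A ν x‖ ≤ ‖algToSpatial A C x‖ := by
  rw [← norm_univRep, univRep_algSlice]
  exact norm_compressRight_le _ (norm_cyclicVector ν) _

variable (C) in
theorem denseRange_algToSpatial : DenseRange (algToSpatial A C) := by
  intro y
  refine closure_subtype.mpr ?_
  have hy : (y.1 : HilbertTensor (UnivSpace A) (UnivSpace C) →L[ℂ] _) ∈
      closure (Set.range (tensorRep (univRep A) (univRep C))) := y.2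
  refine closure_mono ?_ hy
  rintro _ ⟨x, rfl⟩
  exact ⟨_, ⟨x, rfl⟩, rfl⟩

theorem slice_algToSpatial (ν : State C) (x : A ⊗[ℂ] C) :
    slice A ν (algToSpatial A C x) = algSlice A ν x := by
  have hd : DenseRange (algToSpatialLinear A C) := denseRange_algToSpatial A C
  have hn : ∃ r, ∀ x, ‖algSlice A ν x‖ ≤ r * ‖algToSpatialLinear A C x‖ :=
    ⟨1, fun x => (norm_algSlice_le A ν x).trans_eq (one_mul _).symm⟩
  exact LinearMap.extendOfNorm_eq hd hn x

end SliceMap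

section RandomQuantumMaps

/-- The elementary tensor `a ⊗ b` in the spatial tensor product. -/
def stmul {A B : Type*} [CStarAlgebra A] [PartialOrder A] [StarOrderedRing A]
    [CStarAlgebra B] [PartialOrder B] [StarOrderedRing B] (a : A) (b : B) : SpatialTensor A B :=
  algToSpatial A B (a ⊗ₜ[ℂ] b)

theorem slice_stmul {A C : Type*} [CStarAlgebra A] [PartialOrder A] [StarOrderedRing A]
    [CStarAlgebra C] [PartialOrder C] [StarOrderedRing C] (ν : State C) (a : A) (c : C) :
    slice A ν (stmul a c) = ν.1 c • a := by
  rw [stmul, slice_algToSpatial, algSlice_tmul]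

/-- A noncommutative Feller-Markov operator from `B` to `A`: a completely positive linear map
`B → A` which preserves the unit. -/
structure FellerMarkov (B A : Type*) [CStarAlgebra B] [PartialOrder B] [StarOrderedRing B]
    [CStarAlgebra A] [PartialOrder A] [StarOrderedRing A] extends CompletelyPositiveMap B A where
  map_one' : toFun 1 = 1

instance {B A : Type*} [CStarAlgebra B] [PartialOrder B] [StarOrderedRing B]
    [CStarAlgebra A] [PartialOrder A] [StarOrderedRing A] :
    CoeFun (FellerMarkov B A) fun _ => B → A where
  coe F := F.toFun

/-- A random quantum map `(C, φ, ν)` from `B` to `A`: a unital C⋆-algebra `C`, a unital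
⋆-homomorphism `φ : B → A ⊗ C` into the spatial tensor product and a state `ν` on `C`. -/
structure RandomQuantumMap (B A : Type*) [CStarAlgebra B] [PartialOrder B] [StarOrderedRing B]
    [CStarAlgebra A] [PartialOrder A] [StarOrderedRing A] where
  C : Type w
  [instCStarAlgebra : CStarAlgebra C]
  [instPartialOrder : PartialOrder C]
  [instStarOrderedRing : StarOrderedRing C]
  φ : B →⋆ₐ[ℂ] SpatialTensor A C
  ν : State C

attribute [instance] RandomQuantumMap.instCStarAlgebra RandomQuantumMap.instPartialOrder
  RandomQuantumMap.instStarOrderedRing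

/-- The operator `b ↦ (id ⊗ ν)(φ b)` associated with a random quantum map `(C, φ, ν)`. -/
def RandomQuantumMap.operator {B A : Type*} [CStarAlgebra B] [PartialOrder B] [StarOrderedRing B]
    [CStarAlgebra A] [PartialOrder A] [StarOrderedRing A] (R : RandomQuantumMap.{w} B A) (b : B) :
    A :=
  slice A R.ν (R.φ b)

/-- `F` is implemented by the random quantum map `R`. -/
def FellerMarkov.ImplementedBy {B A : Type*} [CStarAlgebra B] [PartialOrder B] [StarOrderedRing B]
    [CStarAlgebra A] [PartialOrder A] [StarOrderedRing A] (F : FellerMarkov B A)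
    (R : RandomQuantumMap.{w} B A) : Prop :=
  ∀ b, F b = R.operator b

/-- `F` is implemented by some random quantum map `(C, φ, ν)` with `C` in `Type w`. -/
def FellerMarkov.Implemented {B A : Type*} [CStarAlgebra B] [PartialOrder B] [StarOrderedRing B]
    [CStarAlgebra A] [PartialOrder A] [StarOrderedRing A] (F : FellerMarkov B A) : Prop :=
  ∃ R : RandomQuantumMap.{w} B A, F.ImplementedBy R

end RandomQuantumMaps

end QuantumMaps

end

open QuantumMaps

/-! For any random quantum map `(C, φ, ν)` the operator `(id ⊗ ν) ∘ φ` is automatically unital and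
completely positive, because the slice map is. So each claim amounts to exhibiting a random quantum
map with the prescribed operator. For a state `σ` of `A` take `C = A` and `a ↦ 1 ⊗ a`; for a
morphism `φ` take a copy of `ℂ` and `b ↦ φ b ⊗ 1`. In the remaining cases take `C₁ ⊗ C₂` with the
product state `ν₁ ⊗ ν₂`. A composition uses `(φ₁ ⊗ id) ∘ φ₂`; a direct sum sends the two outputs to
`A₁ ⊗ C₁ ⊗ 1` and `A₂ ⊗ 1 ⊗ C₂`; a tensor product uses `φ₁ ⊗ φ₂` followed by exchanging the two
inner factors. The slice identities (`slice_spatialMap`, `slice_spatialShuffle`,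
`slice_spatialProd`) are checked on elementary tensors and extended by continuity.

The analytic work is that these morphisms exist for the spatial norm, which is defined by the
universal representations. The key is `norm_tensorRep_le_max`: `‖(ρ ⊗ σ) x‖` is at most the maximum
over two representations `ρ₁`, `ρ₂` that are jointly faithful on the first leg. Compressing the
second leg to a finite-dimensional subspace turns `x` into a matrix over `A` that does not depend on
the representation of `A`. A faithful representation of the matrix algebra is isometric and every
representation is contractive, so the bound follows. Hence any two faithful representations compute
the spatial norm and all others are dominated by it, which gives `f ⊗ g`, the shuffle and the direct
sum morphism by extension from the algebraic tensor product.

Complete positivity of the slice comes from writing it as a compression `V⋆ y V` with `V x = x ⊗ η`,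
where `η` is the cyclic vector of the state. -/

noncomputable section

namespace QuantumMaps

/-! ### Compressions of the second leg and representations of matrix algebras -/

section Compression

variable {H K : Type*} [NormedAddCommGroup H] [InnerProductSpace ℂ H] [CompleteSpace H]
  [NormedAddCommGroup K] [InnerProductSpace ℂ K]

theorem adjoint_tensorRight_comp_opTensor_comp (η η' : K) (S : H →L[ℂ] H) (T : K →L[ℂ] K) :
    ContinuousLinearMap.adjoint (tensorRight η) ∘L opTensor S T ∘L tensorRight η' =
      ⟪η, T η'⟫_ℂ • S := by
  ext y
  refine ext_inner_left ℂ fun x => ?_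
  simp only [ContinuousLinearMap.comp_apply]
  rw [ContinuousLinearMap.adjoint_inner_right, tensorRight_apply, tensorRight_apply, opTensor_tmul,
    inner_toHilbertTensor_tmul, smul_apply, inner_smul_right, mul_comm]

theorem adjoint_tensorRight_comp_tensorRight (η η' : K) :
    ContinuousLinearMap.adjoint (tensorRight η) ∘L tensorRight η' =
      ⟪η, η'⟫_ℂ • (1 : H →L[ℂ] H) := by
  have h := adjoint_tensorRight_comp_opTensor_comp (H := H) η η' 1 1
  rw [opTensor_one] at h
  exact h

theorem adjoint_tensorRight_tmul (η : K) (x : H) (y : K) :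
    ContinuousLinearMap.adjoint (tensorRight η) (toHilbertTensor H K (x ⊗ₜ[ℂ] y)) =
      ⟪η, y⟫_ℂ • x :=
  congrArg (fun T => T x) (adjoint_tensorRight_comp_tensorRight (H := H) η y)

end Compression

section MatrixRep

variable {A C H K ι : Type*} [CStarAlgebra A] [CStarAlgebra C]
  [NormedAddCommGroup H] [InnerProductSpace ℂ H] [CompleteSpace H]
  [NormedAddCommGroup K] [InnerProductSpace ℂ K]
  [Fintype ι] [DecidableEq ι]

/-- The map `M ↦ ∑ i j, ρ (M i j) ⊗ |e i⟩⟨e j|`. -/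
def matrixRepAux (ρ : A →⋆ₐ[ℂ] (H →L[ℂ] H)) (e : ι → K) (M : CStarMatrix ι ι A) :
    HilbertTensor H K →L[ℂ] HilbertTensor H K :=
  ∑ i, ∑ j, tensorRight (e i) ∘L ρ (M i j) ∘L ContinuousLinearMap.adjoint (tensorRight (e j))

/-- Orthonormality gives `V_j⋆ V_k = δ_jk` for `V_j x = x ⊗ e_j`, so only column `k` survives.
Multiplicativity of `matrixRep` rests on this. -/
theorem matrixRepAux_comp_tensorRight (ρ : A →⋆ₐ[ℂ] (H →L[ℂ] H)) {e : ι → K}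
    (he : Orthonormal ℂ e) (M : CStarMatrix ι ι A) (k : ι) :
    matrixRepAux ρ e M ∘L tensorRight (e k) = ∑ i, tensorRight (e i) ∘L ρ (M i k) := by
  rw [matrixRepAux, ContinuousLinearMap.finsetSum_comp]
  refine Finset.sum_congr rfl fun i _ => ?_
  rw [ContinuousLinearMap.finsetSum_comp, Finset.sum_eq_single k]
  · rw [ContinuousLinearMap.comp_assoc, ContinuousLinearMap.comp_assoc,
      adjoint_tensorRight_comp_tensorRight, orthonormal_iff_ite.mp he, if_pos rfl, one_smul]
    rfl
  · intro j _ hj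
    rw [ContinuousLinearMap.comp_assoc, ContinuousLinearMap.comp_assoc,
      adjoint_tensorRight_comp_tensorRight, orthonormal_iff_ite.mp he, if_neg hj, zero_smul]
    simp
  · simp

/-- The non-unital representation `M ↦ ∑ i j, ρ (M i j) ⊗ |e i⟩⟨e j|` of the matrix algebra
attached to an orthonormal family `e`. -/
def matrixRep (ρ : A →⋆ₐ[ℂ] (H →L[ℂ] H)) {e : ι → K} (he : Orthonormal ℂ e) :
    CStarMatrix ι ι A →⋆ₙₐ[ℂ] (HilbertTensor H K →L[ℂ] HilbertTensor H K) where
  toFun := matrixRepAux ρ e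
  map_smul' r M := by
    simp [matrixRepAux, Finset.smul_sum]
  map_zero' := by simp [matrixRepAux]
  map_add' M N := by
    simp [matrixRepAux, Finset.sum_add_distrib]
  map_mul' M N := by
    have h : matrixRepAux ρ e M * matrixRepAux ρ e N = ∑ k, ∑ l,
        (matrixRepAux ρ e M ∘L tensorRight (e k)) ∘L ρ (N k l) ∘L
          ContinuousLinearMap.adjoint (tensorRight (e l)) := by
      conv_lhs => rw [matrixRepAux.eq_def ρ e N]
      simp only [Finset.mul_sum]
      rfl
    rw [h]
    simp only [matrixRepAux_comp_tensorRight ρ he, ContinuousLinearMap.finsetSum_comp]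
    rw [matrixRepAux]
    simp only [CStarMatrix.mul_apply, map_sum, map_mul]
    rw [Finset.sum_comm]
    conv_rhs => rw [Finset.sum_comm]
    refine Finset.sum_congr rfl fun l _ => ?_
    rw [Finset.sum_comm]
    refine Finset.sum_congr rfl fun i _ => ?_
    rw [ContinuousLinearMap.finsetSum_comp, ContinuousLinearMap.comp_finsetSum]
    rfl
  map_star' M := by
    simp only [matrixRepAux, star_sum]
    rw [Finset.sum_comm]
    refine Finset.sum_congr rfl fun i _ => Finset.sum_congr rfl fun j _ => ?_
    rw [CStarMatrix.star_apply, map_star, ContinuousLinearMap.star_eq_adjoint,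
      ContinuousLinearMap.star_eq_adjoint, ContinuousLinearMap.adjoint_comp,
      ContinuousLinearMap.adjoint_comp, ContinuousLinearMap.adjoint_adjoint,
      ContinuousLinearMap.comp_assoc]

theorem matrixRep_apply (ρ : A →⋆ₐ[ℂ] (H →L[ℂ] H)) {e : ι → K} (he : Orthonormal ℂ e)
    (M : CStarMatrix ι ι A) : matrixRep ρ he M =
      ∑ i, ∑ j, tensorRight (e i) ∘L ρ (M i j) ∘L
        ContinuousLinearMap.adjoint (tensorRight (e j)) := rfl

/-- The entries can be read off from the operator; this is what transfers faithfulness of `ρ` to the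
matrix algebra. -/
theorem compress_matrixRep (ρ : A →⋆ₐ[ℂ] (H →L[ℂ] H)) {e : ι → K} (he : Orthonormal ℂ e)
    (M : CStarMatrix ι ι A) (i j : ι) :
    ContinuousLinearMap.adjoint (tensorRight (e i)) ∘L matrixRep ρ he M ∘L tensorRight (e j) =
      ρ (M i j) := by
  have h : matrixRep ρ he M ∘L tensorRight (e j) = _ := matrixRepAux_comp_tensorRight ρ he M j
  rw [h, ContinuousLinearMap.comp_finsetSum, Finset.sum_eq_single i]
  · rw [← ContinuousLinearMap.comp_assoc, adjoint_tensorRight_comp_tensorRight,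
      orthonormal_iff_ite.mp he, if_pos rfl, one_smul]
    rfl
  · intro k _ hk
    rw [← ContinuousLinearMap.comp_assoc, adjoint_tensorRight_comp_tensorRight,
      orthonormal_iff_ite.mp he, if_neg hk.symm, zero_smul]
    simp
  · simp

theorem matrixRep_one (ρ : A →⋆ₐ[ℂ] (H →L[ℂ] H)) {e : ι → K} (he : Orthonormal ℂ e) :
    matrixRep ρ he 1 =
      ∑ i, tensorRight (e i) ∘L ContinuousLinearMap.adjoint (tensorRight (e i)) := by
  rw [matrixRep_apply]
  refine Finset.sum_congr rfl fun i _ => ?_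
  rw [Finset.sum_eq_single i]
  · rw [CStarMatrix.one_apply_eq, map_one]; rfl
  · intro j _ hj
    rw [CStarMatrix.one_apply_ne hj.symm, map_zero]; simp
  · simp

/-- The image `p` of the unit is a projection, so the C⋆-identity reads `‖p‖ = ‖p‖²`. -/
theorem norm_matrixRep_one_le (ρ : A →⋆ₐ[ℂ] (H →L[ℂ] H)) {e : ι → K} (he : Orthonormal ℂ e) :
    ‖matrixRep ρ he 1‖ ≤ 1 := by
  have h := CStarRing.norm_star_mul_self (x := matrixRep ρ he 1)
  rw [← map_star, ← map_mul, star_one, one_mul] at h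
  nlinarith [norm_nonneg (matrixRep ρ he 1)]

theorem matrixRep_one_apply_of_mem (ρ : A →⋆ₐ[ℂ] (H →L[ℂ] H)) {W : Submodule ℂ K}
    (b : OrthonormalBasis ι ℂ W) (he : Orthonormal ℂ fun i => (b i : K)) {z : H ⊗[ℂ] K}
    (hz : z ∈ LinearMap.range (W.subtype.lTensor H)) :
    matrixRep ρ he 1 (toHilbertTensor H K z) = toHilbertTensor H K z := by
  obtain ⟨z, rfl⟩ := hz
  induction z with
  | zero => simp only [map_zero]
  | add x y hx hy => simp only [map_add, hx, hy]
  | tmul x y =>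
    rw [LinearMap.lTensor_tmul, matrixRep_one, sum_apply]
    simp only [ContinuousLinearMap.comp_apply, adjoint_tensorRight_tmul, map_smul,
      tensorRight_apply]
    simp only [← map_smul, ← map_sum, ← TensorProduct.tmul_smul, ← TensorProduct.tmul_sum]
    congr 2
    have h := congrArg W.subtype (b.sum_repr' y)
    rw [map_sum] at h
    simpa using h

variable [CompleteSpace K]

/-- The slice of an algebraic tensor by the functional `c ↦ ⟪η, σ c η'⟫`. -/
def vectorSlice (A : Type*) [CStarAlgebra A] (σ : C →⋆ₐ[ℂ] (K →L[ℂ] K)) (η η' : K) :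
    A ⊗[ℂ] C →ₗ[ℂ] A :=
  (TensorProduct.rid ℂ A : A ⊗[ℂ] ℂ →ₗ[ℂ] A) ∘ₗ
    (((innerSL ℂ η : K →L[ℂ] ℂ) : K →ₗ[ℂ] ℂ) ∘ₗ (ContinuousLinearMap.apply ℂ K η' :
      (K →L[ℂ] K) →ₗ[ℂ] K) ∘ₗ (σ : C →ₗ[ℂ] (K →L[ℂ] K))).lTensor A

theorem vectorSlice_tmul (σ : C →⋆ₐ[ℂ] (K →L[ℂ] K)) (η η' : K) (a : A) (c : C) :
    vectorSlice A σ η η' (a ⊗ₜ[ℂ] c) = ⟪η, σ c η'⟫_ℂ • a := by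
  simp [vectorSlice]

/-- The matrix of slices of `x` by the functionals `c ↦ ⟪e i, σ c (e j)⟫`. -/
def sliceMatrix (A : Type*) [CStarAlgebra A] (σ : C →⋆ₐ[ℂ] (K →L[ℂ] K)) (e : ι → K)
    (x : A ⊗[ℂ] C) : CStarMatrix ι ι A :=
  CStarMatrix.ofMatrix fun i j => vectorSlice A σ (e i) (e j) x

omit [Fintype ι] [DecidableEq ι] in
-- Slicing the second leg already happens in `A`, before `ρ` is applied: the same matrix over `A`
-- serves every representation of `A`.
theorem compress_tensorRep (ρ : A →⋆ₐ[ℂ] (H →L[ℂ] H)) (σ : C →⋆ₐ[ℂ] (K →L[ℂ] K)) (e : ι → K)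
    (x : A ⊗[ℂ] C) (i j : ι) :
    ContinuousLinearMap.adjoint (tensorRight (e i)) ∘L tensorRep ρ σ x ∘L tensorRight (e j) =
      ρ (sliceMatrix A σ e x i j) := by
  change _ = ρ (vectorSlice A σ (e i) (e j) x)
  induction x with
  | zero => simp
  | add x y hx hy => rw [map_add, map_add, map_add, ← hx, ← hy]; simp
  | tmul a c =>
    rw [tensorRep_tmul, adjoint_tensorRight_comp_opTensor_comp, vectorSlice_tmul, map_smul]

/-- With `p = ∑ V_i V_i⋆`, the product `p T p` expands as `∑ V_i (V_i⋆ T V_j) V_j⋆`, whose middle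
factors are the sliced entries. -/
theorem matrixRep_sliceMatrix (ρ : A →⋆ₐ[ℂ] (H →L[ℂ] H)) (σ : C →⋆ₐ[ℂ] (K →L[ℂ] K)) {e : ι → K}
    (he : Orthonormal ℂ e) (x : A ⊗[ℂ] C) :
    matrixRep ρ he (sliceMatrix A σ e x) =
      matrixRep ρ he 1 * tensorRep ρ σ x * matrixRep ρ he 1 := by
  rw [matrixRep_one, matrixRep_apply]
  simp only [← compress_tensorRep, Finset.sum_mul, Finset.mul_sum]
  rw [Finset.sum_comm]
  rfl

theorem norm_matrixRep_sliceMatrix_le (ρ : A →⋆ₐ[ℂ] (H →L[ℂ] H)) (σ : C →⋆ₐ[ℂ] (K →L[ℂ] K))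
    {e : ι → K} (he : Orthonormal ℂ e) (x : A ⊗[ℂ] C) :
    ‖matrixRep ρ he (sliceMatrix A σ e x)‖ ≤ ‖tensorRep ρ σ x‖ := by
  rw [matrixRep_sliceMatrix]
  have h := norm_matrixRep_one_le ρ he
  calc _ ≤ ‖matrixRep ρ he 1‖ * ‖tensorRep ρ σ x‖ * ‖matrixRep ρ he 1‖ := by
        refine (norm_mul_le _ _).trans ?_
        gcongr
        exact norm_mul_le _ _
    _ ≤ 1 * ‖tensorRep ρ σ x‖ * 1 := by gcongr
    _ = _ := by ring

end MatrixRep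

/-! ### Comparing spatial norms of different representations -/

section NormComparison

variable {A C H K : Type*} [CStarAlgebra A] [CStarAlgebra C]
  [NormedAddCommGroup H] [InnerProductSpace ℂ H] [CompleteSpace H]
  [NormedAddCommGroup K] [InnerProductSpace ℂ K] [CompleteSpace K]

theorem exists_tensorRep_toHilbertTensor (ρ : A →⋆ₐ[ℂ] (H →L[ℂ] H)) (σ : C →⋆ₐ[ℂ] (K →L[ℂ] K))
    (x : A ⊗[ℂ] C) (z : H ⊗[ℂ] K) :
    ∃ z', tensorRep ρ σ x (toHilbertTensor H K z) = toHilbertTensor H K z' := by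
  induction x with
  | zero => exact ⟨0, by simp⟩
  | add x y hx hy =>
    obtain ⟨⟨z₁, h₁⟩, z₂, h₂⟩ := And.intro hx hy
    exact ⟨z₁ + z₂, by rw [map_add, add_apply, h₁, h₂, map_add]⟩
  | tmul a c =>
    exact ⟨TensorProduct.mapL (ρ a) (σ c) z,
      ContinuousLinearMap.completion_apply_coe (TensorProduct.mapL (ρ a) (σ c)) z⟩

/-- The norm of `(ρ ⊗ σ) x` is controlled by the norms of `(ρ₁ ⊗ σ) x` and `(ρ₂ ⊗ σ) x` as soon as
`ρ₁ ⊕ ρ₂` is faithful. -/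
theorem norm_tensorRep_le_max [PartialOrder A] [StarOrderedRing A] {H₁ H₂ : Type*}
    [NormedAddCommGroup H₁] [InnerProductSpace ℂ H₁] [CompleteSpace H₁]
    [NormedAddCommGroup H₂] [InnerProductSpace ℂ H₂] [CompleteSpace H₂]
    (ρ : A →⋆ₐ[ℂ] (H →L[ℂ] H)) (ρ₁ : A →⋆ₐ[ℂ] (H₁ →L[ℂ] H₁)) (ρ₂ : A →⋆ₐ[ℂ] (H₂ →L[ℂ] H₂))
    (hρ : ∀ a, ρ₁ a = 0 → ρ₂ a = 0 → a = 0) (σ : C →⋆ₐ[ℂ] (K →L[ℂ] K)) (x : A ⊗[ℂ] C) :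
    ‖tensorRep ρ σ x‖ ≤ max ‖tensorRep ρ₁ σ x‖ ‖tensorRep ρ₂ σ x‖ := by
  refine ContinuousLinearMap.opNorm_le_bound _ (le_max_of_le_left (norm_nonneg _)) fun ζ => ?_
  refine (denseRange_toHilbertTensor H K).induction_on ζ
    (isClosed_le (by fun_prop) (by fun_prop)) fun z => ?_
  obtain ⟨z', hz'⟩ := exists_tensorRep_toHilbertTensor ρ σ x z
  -- `W` contains the second legs of both the vector and its image, so the projection onto `H ⊗ W`
  -- fixes both and the compression of `x` acts on `z` exactly as `x` does.
  obtain ⟨W, hW, hzW⟩ := TensorProduct.exists_finite_submodule_right_of_setFinite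
    ({z, z'} : Set (H ⊗[ℂ] K)) (Set.toFinite _)
  let b := stdOrthonormalBasis ℂ W
  have he : Orthonormal ℂ fun i => (b i : K) := b.orthonormal.comp_linearIsometry W.subtypeₗᵢ
  -- Joint faithfulness holds entry by entry, hence for matrices.
  have hinj : Function.Injective ((matrixRep ρ₁ he).prod (matrixRep ρ₂ he)) := by
    rw [injective_iff_map_eq_zero]
    intro M hM
    have hM₁ : matrixRep ρ₁ he M = 0 := congrArg Prod.fst hM
    have hM₂ : matrixRep ρ₂ he M = 0 := congrArg Prod.snd hM
    ext i j
    refine hρ _ ?_ ?_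
    · rw [← compress_matrixRep ρ₁ he, hM₁]; simp
    · rw [← compress_matrixRep ρ₂ he, hM₂]; simp
  have hz : matrixRep ρ he (sliceMatrix A σ (fun i => (b i : K)) x) (toHilbertTensor H K z) =
      tensorRep ρ σ x (toHilbertTensor H K z) := by
    rw [matrixRep_sliceMatrix, mul_apply_eq_comp, mul_apply_eq_comp,
      matrixRep_one_apply_of_mem ρ b he (hzW (by simp)), hz',
      matrixRep_one_apply_of_mem ρ b he (hzW (by simp))]
  rw [← hz]
  refine (ContinuousLinearMap.le_opNorm _ _).trans (mul_le_mul_of_nonneg_right ?_ (norm_nonneg _))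
  -- The representation through `ρ` is contractive; the injective one through `ρ₁` and `ρ₂` is
  -- isometric, and the norm of a pair is the maximum.
  refine (NonUnitalStarAlgHom.norm_apply_le (matrixRep ρ he) _).trans ?_
  rw [← NonUnitalStarAlgHom.norm_map _ hinj]
  exact max_le_max (norm_matrixRep_sliceMatrix_le ρ₁ σ he x)
    (norm_matrixRep_sliceMatrix_le ρ₂ σ he x)

end NormComparison

end QuantumMaps

namespace QuantumMaps

/-! ### Independence of the spatial norm from the choice of faithful representations -/

section Independence

/-- Both operators restrict to the same partial action on `V`, seen through two maps inducing the
same seminorm. Density is needed only on the side whose operator is being bounded. Used for the flip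
and for the four-fold shuffle. -/
theorem norm_le_norm_of_intertwine {V H H' : Type*} [AddCommGroup V] [Module ℂ V]
    [NormedAddCommGroup H] [NormedSpace ℂ H] [NormedAddCommGroup H'] [NormedSpace ℂ H']
    (E : V →ₗ[ℂ] H) (E' : V →ₗ[ℂ] H') (hE' : DenseRange E') (hn : ∀ v, ‖E' v‖ = ‖E v‖)
    (S : H →L[ℂ] H) (S' : H' →L[ℂ] H') (h : ∀ v, ∃ v', S (E v) = E v' ∧ S' (E' v) = E' v') :
    ‖S'‖ ≤ ‖S‖ := by
  refine ContinuousLinearMap.opNorm_le_bound _ (norm_nonneg _) fun ζ => ?_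
  refine hE'.induction_on ζ (isClosed_le (by fun_prop) (by fun_prop)) fun v => ?_
  obtain ⟨v', h₁, h₂⟩ := h v
  rw [h₂, hn, hn, ← h₁]
  exact S.le_opNorm _

variable {A C H H' K K' : Type*} [CStarAlgebra A] [CStarAlgebra C]
  [NormedAddCommGroup H] [InnerProductSpace ℂ H] [CompleteSpace H]
  [NormedAddCommGroup H'] [InnerProductSpace ℂ H'] [CompleteSpace H']
  [NormedAddCommGroup K] [InnerProductSpace ℂ K] [CompleteSpace K]
  [NormedAddCommGroup K'] [InnerProductSpace ℂ K'] [CompleteSpace K']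

theorem norm_tensorRep_comm_le (ρ : A →⋆ₐ[ℂ] (H →L[ℂ] H)) (σ : C →⋆ₐ[ℂ] (K →L[ℂ] K))
    (x : A ⊗[ℂ] C) :
    ‖tensorRep σ ρ (TensorProduct.comm ℂ A C x)‖ ≤ ‖tensorRep ρ σ x‖ := by
  refine norm_le_norm_of_intertwine (toHilbertTensor H K).toLinearMap
    ((toHilbertTensor K H).toLinearMap ∘ₗ (TensorProduct.comm ℂ H K : H ⊗[ℂ] K →ₗ[ℂ] K ⊗[ℂ] H))
    ((denseRange_toHilbertTensor K H).comp (TensorProduct.comm ℂ H K).surjective.denseRange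
      (toHilbertTensor K H).continuous)
    (fun v => ?_) _ _ fun v => ?_
  · change ‖toHilbertTensor K H (TensorProduct.comm ℂ H K v)‖ = ‖toHilbertTensor H K v‖
    rw [LinearIsometry.norm_map, LinearIsometry.norm_map, TensorProduct.norm_comm]
  · simp only [LinearMap.comp_apply, LinearIsometry.coe_toLinearMap, LinearEquiv.coe_coe]
    induction x with
    | zero => exact ⟨0, by simp⟩
    | add x y hx hy =>
      obtain ⟨⟨v₁, h₁, h₁'⟩, v₂, h₂, h₂'⟩ := And.intro hx hy
      exact ⟨v₁ + v₂, by simp only [map_add, add_apply, h₁, h₂],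
        by simp only [map_add, add_apply, h₁', h₂']⟩
    | tmul a c =>
      induction v with
      | zero => exact ⟨0, by simp⟩
      | add x y hx hy =>
        obtain ⟨⟨v₁, h₁, h₁'⟩, v₂, h₂, h₂'⟩ := And.intro hx hy
        exact ⟨v₁ + v₂, by simp only [map_add, h₁, h₂], by simp only [map_add, h₁', h₂']⟩
      | tmul x y =>
        exact ⟨ρ a x ⊗ₜ σ c y, by rw [tensorRep_tmul, opTensor_tmul],
          by simp only [TensorProduct.comm_tmul, tensorRep_tmul, opTensor_tmul]⟩

variable [PartialOrder A] [StarOrderedRing A]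

theorem norm_tensorRep_le_of_injective_left (ρ : A →⋆ₐ[ℂ] (H →L[ℂ] H))
    (ρ' : A →⋆ₐ[ℂ] (H' →L[ℂ] H')) (hρ' : Function.Injective ρ') (σ : C →⋆ₐ[ℂ] (K →L[ℂ] K))
    (x : A ⊗[ℂ] C) : ‖tensorRep ρ σ x‖ ≤ ‖tensorRep ρ' σ x‖ := by
  have h := norm_tensorRep_le_max ρ ρ' ρ' (fun a ha _ => (map_eq_zero_iff ρ' hρ').mp ha) σ x
  rwa [max_self] at h

variable [PartialOrder C] [StarOrderedRing C]

/-- The norm of `(ρ ⊗ σ) x` is the largest possible when `ρ` and `σ` are faithful. -/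
theorem norm_tensorRep_le_of_injective (ρ : A →⋆ₐ[ℂ] (H →L[ℂ] H)) (ρ' : A →⋆ₐ[ℂ] (H' →L[ℂ] H'))
    (hρ' : Function.Injective ρ') (σ : C →⋆ₐ[ℂ] (K →L[ℂ] K)) (σ' : C →⋆ₐ[ℂ] (K' →L[ℂ] K'))
    (hσ' : Function.Injective σ') (x : A ⊗[ℂ] C) :
    ‖tensorRep ρ σ x‖ ≤ ‖tensorRep ρ' σ' x‖ := by
  -- Replace the first leg, flip, replace what is now the first leg, and flip back.
  refine (norm_tensorRep_le_of_injective_left ρ ρ' hρ' σ x).trans ?_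
  have h₁ := norm_tensorRep_comm_le σ ρ' (TensorProduct.comm ℂ A C x)
  have h₂ := norm_tensorRep_le_of_injective_left σ σ' hσ' ρ' (TensorProduct.comm ℂ A C x)
  rw [TensorProduct.comm_comm] at h₁
  exact h₁.trans (h₂.trans (norm_tensorRep_comm_le ρ' σ' x))

theorem norm_algToSpatial (x : A ⊗[ℂ] C) :
    ‖algToSpatial A C x‖ = ‖tensorRep (univRep A) (univRep C) x‖ := rfl

/-- The universal representations are faithful, so they dominate every other pair. -/
theorem norm_tensorRep_le (ρ : A →⋆ₐ[ℂ] (H →L[ℂ] H)) (σ : C →⋆ₐ[ℂ] (K →L[ℂ] K))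
    (x : A ⊗[ℂ] C) : ‖tensorRep ρ σ x‖ ≤ ‖algToSpatial A C x‖ :=
  norm_tensorRep_le_of_injective ρ _ univRep_injective σ _ univRep_injective x

theorem norm_algToSpatial_le (ρ : A →⋆ₐ[ℂ] (H →L[ℂ] H)) (hρ : Function.Injective ρ)
    (σ : C →⋆ₐ[ℂ] (K →L[ℂ] K)) (hσ : Function.Injective σ) (x : A ⊗[ℂ] C) :
    ‖algToSpatial A C x‖ ≤ ‖tensorRep ρ σ x‖ :=
  norm_tensorRep_le_of_injective _ ρ hρ _ σ hσ x

/-- The inclusion of the spatial tensor product in the operators on the Hilbert space tensor product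
of the universal representation spaces. -/
def spatialInclusion (A C : Type*) [CStarAlgebra A] [PartialOrder A] [StarOrderedRing A]
    [CStarAlgebra C] [PartialOrder C] [StarOrderedRing C] :
    SpatialTensor A C →⋆ₐ[ℂ] (HilbertTensor (UnivSpace A) (UnivSpace C) →L[ℂ]
      HilbertTensor (UnivSpace A) (UnivSpace C)) :=
  (tensorRep (univRep A) (univRep C)).range.topologicalClosure.subtype

theorem spatialInclusion_algToSpatial (x : A ⊗[ℂ] C) :
    spatialInclusion A C (algToSpatial A C x) = tensorRep (univRep A) (univRep C) x := rfl

theorem spatialInclusion_injective : Function.Injective (spatialInclusion A C) :=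
  Subtype.val_injective

end Independence

attribute [local irreducible] instCStarAlgebraSpatialTensor

/-! ### Extending homomorphisms from dense subalgebras -/

section Lift

/-- A ⋆-homomorphism defined on a dense subalgebra by a norm estimate. -/
theorem exists_starAlgHom_of_norm_le {D X Y : Type*} [Ring D] [Algebra ℂ D] [CStarAlgebra X]
    [CStarAlgebra Y] (e : D →ₐ[ℂ] X) (f : D →ₐ[ℂ] Y) (he : DenseRange e)
    (hn : ∀ d, ‖f d‖ ≤ ‖e d‖) (hs : ∀ d, ∃ d', e d' = star (e d) ∧ f d' = star (f d)) :
    ∃ g : X →⋆ₐ[ℂ] Y, ∀ d, g (e d) = f d := by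
  let g : X →L[ℂ] Y := f.toLinearMap.extendOfNorm e.toLinearMap
  have hg : ∀ d, g (e d) = f d := fun d =>
    LinearMap.extendOfNorm_eq (f := f.toLinearMap) (e := e.toLinearMap) he
      ⟨1, fun d => (hn d).trans_eq (one_mul _).symm⟩ d
  have h1 : g 1 = 1 := by rw [← map_one e, hg, map_one]
  have hmul : ∀ x y, g (x * y) = g x * g y := fun x y =>
    he.induction_on₂ (p := fun x y => g (x * y) = g x * g y)
      (isClosed_eq (by fun_prop) (by fun_prop))
      (fun a b => by rw [← map_mul, hg, hg, hg, map_mul]) x y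
  -- `D` is not assumed to have a star; an element mapped by `e` and `f` to the two adjoints takes
  -- its place.
  have hstar : ∀ x, g (star x) = star (g x) := fun x =>
    he.induction_on (p := fun x => g (star x) = star (g x)) x
      (isClosed_eq (by fun_prop) (by fun_prop)) fun d => by
        obtain ⟨d', h₁, h₂⟩ := hs d
        rw [← h₁, hg, hg, h₂]
  exact ⟨{ AlgHom.ofLinearMap (g : X →ₗ[ℂ] Y) h1 hmul with map_star' := hstar }, hg⟩

theorem exists_starAlgHom_prod_of_norm_le {D X₁ X₂ Y : Type*} [Ring D] [Algebra ℂ D]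
    [CStarAlgebra X₁] [CStarAlgebra X₂] [CStarAlgebra Y] (e : D →ₐ[ℂ] X₁ × X₂) (f : D →ₐ[ℂ] Y)
    (he : DenseRange e) (hn : ∀ d, ‖f d‖ ≤ ‖e d‖)
    (hs : ∀ d, ∃ d', e d' = star (e d) ∧ f d' = star (f d)) :
    ∃ g : X₁ × X₂ →⋆ₐ[ℂ] Y, ∀ d, g (e d) = f d :=
  exists_starAlgHom_of_norm_le e f he hn hs

theorem exists_star_of_tmul {D₁ D₂ X Y : Type*} [Ring D₁] [Algebra ℂ D₁] [Ring D₂]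
    [Algebra ℂ D₂] [CStarAlgebra X] [CStarAlgebra Y]
    (e : D₁ ⊗[ℂ] D₂ →ₐ[ℂ] X) (f : D₁ ⊗[ℂ] D₂ →ₐ[ℂ] Y)
    (h : ∀ a b, ∃ d', e d' = star (e (a ⊗ₜ b)) ∧ f d' = star (f (a ⊗ₜ b))) (d : D₁ ⊗[ℂ] D₂) :
    ∃ d', e d' = star (e d) ∧ f d' = star (f d) := by
  induction d with
  | zero => exact ⟨0, by simp⟩
  | add x y hx hy =>
    obtain ⟨⟨v₁, h₁, h₁'⟩, v₂, h₂, h₂'⟩ := And.intro hx hy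
    exact ⟨v₁ + v₂, by simp only [map_add, star_add, h₁, h₂],
      by simp only [map_add, star_add, h₁', h₂']⟩
  | tmul a b => exact h a b

/-- The closure of the range is a closed subspace, so it is enough to reach `T (x ⊗ y)`;
approximating `x` and `y` separately needs only joint continuity on pairs. -/
theorem denseRange_comp_map {V W X Y Z : Type*} [AddCommGroup V] [Module ℂ V] [AddCommGroup W]
    [Module ℂ W] [NormedAddCommGroup X] [NormedSpace ℂ X] [NormedAddCommGroup Y] [NormedSpace ℂ Y]
    [NormedAddCommGroup Z] [NormedSpace ℂ Z] (T : X ⊗[ℂ] Y →ₗ[ℂ] Z) (hT : DenseRange T)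
    (hc : Continuous fun p : X × Y => T (p.1 ⊗ₜ p.2)) (j : V →ₗ[ℂ] X) (hj : DenseRange j)
    (k : W →ₗ[ℂ] Y) (hk : DenseRange k) :
    DenseRange (T ∘ₗ TensorProduct.map j k) := by
  let S := (LinearMap.range (T ∘ₗ TensorProduct.map j k)).topologicalClosure
  have hS : IsClosed (S : Set Z) := Submodule.isClosed_topologicalClosure _
  suffices h : ∀ z, z ∈ S from fun z => h z
  intro z
  refine hT.induction_on z hS fun t => ?_
  induction t with
  | zero => rw [map_zero]; exact S.zero_mem
  | add x y hx hy => rw [map_add]; exact S.add_mem hx hy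
  | tmul x y =>
    refine (hj.prodMap hk).induction_on (p := fun q : X × Y => T (q.1 ⊗ₜ q.2) ∈ S) (x, y)
      (hS.preimage hc) fun q => ?_
    exact Submodule.le_topologicalClosure _ ⟨q.1 ⊗ₜ q.2, by simp⟩

end Lift

/-! ### Elementary tensors in the spatial tensor product -/

section Elementary

variable {A C : Type*} [CStarAlgebra A] [PartialOrder A] [StarOrderedRing A]
  [CStarAlgebra C] [PartialOrder C] [StarOrderedRing C]

theorem norm_opTensor_le {H K : Type*} [NormedAddCommGroup H] [InnerProductSpace ℂ H]
    [NormedAddCommGroup K] [InnerProductSpace ℂ K] (S : H →L[ℂ] H) (T : K →L[ℂ] K) :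
    ‖opTensor S T‖ ≤ ‖S‖ * ‖T‖ := by
  refine ContinuousLinearMap.opNorm_le_bound _ (by positivity) fun ζ => ?_
  refine (denseRange_toHilbertTensor H K).induction_on ζ
    (isClosed_le (by fun_prop) (by fun_prop)) fun z => ?_
  have h : opTensor S T (toHilbertTensor H K z) =
      toHilbertTensor H K (TensorProduct.mapL S T z) :=
    ContinuousLinearMap.completion_apply_coe (TensorProduct.mapL S T) z
  rw [h, LinearIsometry.norm_map, LinearIsometry.norm_map]
  exact (ContinuousLinearMap.le_opNorm _ _).trans
    (mul_le_mul_of_nonneg_right (TensorProduct.norm_mapL_le S T) (norm_nonneg _))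

theorem norm_stmul_le (a : A) (c : C) : ‖stmul a c‖ ≤ ‖a‖ * ‖c‖ := by
  rw [stmul, norm_algToSpatial, tensorRep_tmul]
  refine (norm_opTensor_le (univRep A a) (univRep C c)).trans_eq ?_
  rw [norm_univRep, norm_univRep]

variable (A C) in
/-- The bounded bilinear map `(a, c) ↦ a ⊗ c` into the spatial tensor product. -/
def stmulL : A →L[ℂ] C →L[ℂ] SpatialTensor A C :=
  ((TensorProduct.mk ℂ A C).compr₂ (algToSpatialLinear A C)).mkContinuous₂ 1
    fun a c => (norm_stmul_le a c).trans_eq (by rw [one_mul])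

theorem stmul_mul (a a' : A) (c c' : C) : stmul a c * stmul a' c' = stmul (a * a') (c * c') := by
  simp only [stmul]
  rw [← map_mul, Algebra.TensorProduct.tmul_mul_tmul]

theorem star_stmul (a : A) (c : C) : star (stmul a c) = stmul (star a) (star c) := by
  simp only [stmul]
  rw [← map_star, TensorProduct.star_tmul]

theorem stmul_one_one : stmul (1 : A) (1 : C) = 1 := by
  rw [stmul, ← Algebra.TensorProduct.one_def, map_one]

theorem continuous_stmul : Continuous fun p : A × C => stmul p.1 p.2 :=
  (stmulL A C).continuous₂

theorem spatial_clm_ext {E : Type*} [NormedAddCommGroup E] [NormedSpace ℂ E]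
    {S T : SpatialTensor A C →L[ℂ] E} (h : ∀ a c, S (stmul a c) = T (stmul a c)) : S = T := by
  ext z
  refine (denseRange_algToSpatial A C).induction_on z
    (isClosed_eq S.continuous T.continuous) fun z => ?_
  induction z with
  | zero => simp only [map_zero]
  | tmul a c => exact h a c
  | add x y hx hy => simp only [map_add, hx, hy]

/-- The ⋆-homomorphism `a ↦ a ⊗ 1`. -/
def spatialLeft (A C : Type*) [CStarAlgebra A] [PartialOrder A] [StarOrderedRing A]
    [CStarAlgebra C] [PartialOrder C] [StarOrderedRing C] : A →⋆ₐ[ℂ] SpatialTensor A C where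
  __ := AlgHom.ofLinearMap (((stmulL A C).flip 1 : A →L[ℂ] _) : A →ₗ[ℂ] SpatialTensor A C)
    stmul_one_one fun a b => by
      change stmul (a * b) 1 = stmul a 1 * stmul b 1
      rw [stmul_mul, one_mul]
  map_star' a := by
    change stmul (star a) 1 = star (stmul a 1)
    rw [star_stmul, star_one]

theorem spatialLeft_apply (a : A) : spatialLeft A C a = stmul a 1 := rfl

/-- The ⋆-homomorphism `c ↦ 1 ⊗ c`. -/
def spatialRight (A C : Type*) [CStarAlgebra A] [PartialOrder A] [StarOrderedRing A]
    [CStarAlgebra C] [PartialOrder C] [StarOrderedRing C] : C →⋆ₐ[ℂ] SpatialTensor A C where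
  __ := AlgHom.ofLinearMap ((stmulL A C 1 : C →L[ℂ] _) : C →ₗ[ℂ] SpatialTensor A C)
    stmul_one_one fun a b => by
      change stmul 1 (a * b) = stmul 1 a * stmul 1 b
      rw [stmul_mul, one_mul]
  map_star' a := by
    change stmul 1 (star a) = star (stmul 1 a)
    rw [star_stmul, star_one]

theorem spatialRight_apply (c : C) : spatialRight A C c = stmul 1 c := rfl

end Elementary

end QuantumMaps

namespace QuantumMaps

attribute [local irreducible] instCStarAlgebraSpatialTensor

/-! ### Functoriality, the unit `ℂ`, and direct sums -/

section SpatialMap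

variable {A C X Y : Type*} [CStarAlgebra A] [PartialOrder A] [StarOrderedRing A]
  [CStarAlgebra C] [PartialOrder C] [StarOrderedRing C]
  [CStarAlgebra X] [PartialOrder X] [StarOrderedRing X]
  [CStarAlgebra Y] [PartialOrder Y] [StarOrderedRing Y]

omit [PartialOrder A] [StarOrderedRing A] [PartialOrder C] [StarOrderedRing C] [PartialOrder X]
  [StarOrderedRing X] [PartialOrder Y] [StarOrderedRing Y] in
theorem tensorRep_map {H K : Type*}
    [NormedAddCommGroup H] [InnerProductSpace ℂ H] [CompleteSpace H]
    [NormedAddCommGroup K] [InnerProductSpace ℂ K] [CompleteSpace K]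
    (ρ : X →⋆ₐ[ℂ] (H →L[ℂ] H)) (σ : Y →⋆ₐ[ℂ] (K →L[ℂ] K)) (f : A →⋆ₐ[ℂ] X) (g : C →⋆ₐ[ℂ] Y)
    (x : A ⊗[ℂ] C) : tensorRep ρ σ (Algebra.TensorProduct.map f.toAlgHom g.toAlgHom x) =
      tensorRep (ρ.comp f) (σ.comp g) x := by
  induction x with
  | zero => simp only [map_zero]
  | add x y hx hy => simp only [map_add, hx, hy]
  | tmul a c => rfl

/-- Pulling the universal representations of `X` and `Y` back along `f` and `g` gives
representations of `A` and `C`, possibly not faithful, so their norm is dominated by the spatial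
one. -/
theorem exists_spatialMap (f : A →⋆ₐ[ℂ] X) (g : C →⋆ₐ[ℂ] Y) :
    ∃ h : SpatialTensor A C →⋆ₐ[ℂ] SpatialTensor X Y,
      ∀ a c, h (stmul a c) = stmul (f a) (g c) := by
  obtain ⟨h, hh⟩ := exists_starAlgHom_of_norm_le (algToSpatial A C).toAlgHom
    ((algToSpatial X Y).toAlgHom.comp (Algebra.TensorProduct.map f.toAlgHom g.toAlgHom))
    (denseRange_algToSpatial A C)
    (fun d => by
      change ‖algToSpatial X Y (Algebra.TensorProduct.map f.toAlgHom g.toAlgHom d)‖ ≤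
        ‖algToSpatial A C d‖
      rw [norm_algToSpatial, tensorRep_map]
      exact norm_tensorRep_le _ _ d)
    (exists_star_of_tmul _ _ fun a b =>
      ⟨star a ⊗ₜ star b, (star_stmul a b).symm, by
        change stmul (f (star a)) (g (star b)) = star (stmul (f a) (g b))
        rw [star_stmul, map_star, map_star]⟩)
  exact ⟨h, fun a c => hh (a ⊗ₜ c)⟩

/-- The tensor product `f ⊗ g` of two ⋆-homomorphisms. -/
def spatialMap (f : A →⋆ₐ[ℂ] X) (g : C →⋆ₐ[ℂ] Y) : SpatialTensor A C →⋆ₐ[ℂ] SpatialTensor X Y :=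
  (exists_spatialMap f g).choose

theorem spatialMap_stmul (f : A →⋆ₐ[ℂ] X) (g : C →⋆ₐ[ℂ] Y) (a : A) (c : C) :
    spatialMap f g (stmul a c) = stmul (f a) (g c) :=
  (exists_spatialMap f g).choose_spec a c

end SpatialMap

section Unit

variable (A : Type*) [CStarAlgebra A] [PartialOrder A] [StarOrderedRing A]

/-- The identity of `ℂ` as a state. -/
def idState : State ℂ := ⟨PositiveLinearMap.mk₀ LinearMap.id fun _ h => h, rfl⟩

theorem exists_spatialRid : ∃ h : SpatialTensor A ℂ →⋆ₐ[ℂ] A, ∀ a z, h (stmul a z) = z • a := by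
  -- The map `a ⊗ z ↦ z • a` is the slice by the identity state of `ℂ`, hence contractive.
  have hs : ∀ x, Algebra.TensorProduct.rid ℂ ℂ A x = algSlice A idState x := fun x => by
    induction x with
    | zero => simp only [map_zero]
    | add x y hx hy => simp only [map_add, hx, hy]
    | tmul a z => rw [algSlice_tmul, Algebra.TensorProduct.rid_tmul]; rfl
  obtain ⟨h, hh⟩ := exists_starAlgHom_of_norm_le (algToSpatial A ℂ).toAlgHom
    (Algebra.TensorProduct.rid ℂ ℂ A).toAlgHom
    (denseRange_algToSpatial A ℂ)
    (fun d => by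
      change ‖Algebra.TensorProduct.rid ℂ ℂ A d‖ ≤ ‖algToSpatial A ℂ d‖
      rw [hs]
      exact norm_algSlice_le A idState d)
    (exists_star_of_tmul _ _ fun a b =>
      ⟨star a ⊗ₜ star b, (star_stmul a b).symm, by
        change Algebra.TensorProduct.rid ℂ ℂ A (star a ⊗ₜ star b) =
          star (Algebra.TensorProduct.rid ℂ ℂ A (a ⊗ₜ b))
        simp⟩)
  exact ⟨h, fun a z => (hh (a ⊗ₜ z)).trans (Algebra.TensorProduct.rid_tmul ℂ z a)⟩

/-- The canonical ⋆-homomorphism `A ⊗ ℂ → A`. -/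
def spatialRid : SpatialTensor A ℂ →⋆ₐ[ℂ] A := (exists_spatialRid A).choose

theorem spatialRid_stmul (a : A) (z : ℂ) : spatialRid A (stmul a z) = z • a :=
  (exists_spatialRid A).choose_spec a z

end Unit

section ProdMap

variable (A₁ A₂ C : Type*) [CStarAlgebra A₁] [PartialOrder A₁] [StarOrderedRing A₁]
  [CStarAlgebra A₂] [PartialOrder A₂] [StarOrderedRing A₂]
  [CStarAlgebra C] [PartialOrder C] [StarOrderedRing C]

/-- The ⋆-homomorphism `(a₁, a₂) ⊗ c ↦ (a₁ ⊗ c, a₂ ⊗ c)` on the algebraic tensor product. -/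
def algToProd : (A₁ × A₂) ⊗[ℂ] C →ₐ[ℂ] SpatialTensor A₁ C × SpatialTensor A₂ C :=
  ((algToSpatial A₁ C).toAlgHom.comp (Algebra.TensorProduct.map
    (StarAlgHom.fst ℂ A₁ A₂).toAlgHom (StarAlgHom.id ℂ C).toAlgHom)).prod
  ((algToSpatial A₂ C).toAlgHom.comp (Algebra.TensorProduct.map
    (StarAlgHom.snd ℂ A₁ A₂).toAlgHom (StarAlgHom.id ℂ C).toAlgHom))

variable {A₁ A₂ C}

theorem algToProd_tmul (a : A₁ × A₂) (c : C) :
    algToProd A₁ A₂ C (a ⊗ₜ c) = (stmul a.1 c, stmul a.2 c) := rfl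

theorem stmul_zero_left {A C : Type*} [CStarAlgebra A] [PartialOrder A] [StarOrderedRing A]
    [CStarAlgebra C] [PartialOrder C] [StarOrderedRing C] (c : C) : stmul (0 : A) c = 0 := by
  rw [stmul, TensorProduct.zero_tmul, map_zero]

theorem algToProd_inl (x : A₁ ⊗[ℂ] C) :
    algToProd A₁ A₂ C ((LinearMap.inl ℂ A₁ A₂).rTensor C x) = (algToSpatial A₁ C x, 0) := by
  induction x with
  | zero => simp only [map_zero, Prod.mk_zero_zero]
  | add x y hx hy => simp only [map_add, hx, hy, Prod.mk_add_mk, add_zero]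
  | tmul a c =>
    rw [LinearMap.rTensor_tmul, algToProd_tmul]
    exact Prod.ext rfl (stmul_zero_left c)

theorem algToProd_inr (x : A₂ ⊗[ℂ] C) :
    algToProd A₁ A₂ C ((LinearMap.inr ℂ A₁ A₂).rTensor C x) = (0, algToSpatial A₂ C x) := by
  induction x with
  | zero => simp only [map_zero, Prod.mk_zero_zero]
  | add x y hx hy => simp only [map_add, hx, hy, Prod.mk_add_mk, add_zero]
  | tmul a c =>
    rw [LinearMap.rTensor_tmul, algToProd_tmul]
    exact Prod.ext (stmul_zero_left c) rfl

theorem denseRange_algToProd : DenseRange (algToProd A₁ A₂ C) := by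
  refine ((denseRange_algToSpatial A₁ C).prodMap (denseRange_algToSpatial A₂ C)).mono ?_
  rintro _ ⟨⟨x, y⟩, rfl⟩
  refine ⟨(LinearMap.inl ℂ A₁ A₂).rTensor C x + (LinearMap.inr ℂ A₁ A₂).rTensor C y, ?_⟩
  rw [map_add, algToProd_inl, algToProd_inr, Prod.mk_add_mk, add_zero, zero_add]
  rfl

/-- The representations of `A₁ × A₂` through the two coordinates are in general not faithful, but
jointly they are. This is why `norm_tensorRep_le_max` allows two representations. -/
theorem norm_algToSpatial_prod_le (d : (A₁ × A₂) ⊗[ℂ] C) :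
    ‖algToSpatial (A₁ × A₂) C d‖ ≤ ‖algToProd A₁ A₂ C d‖ := by
  have h := norm_tensorRep_le_max (univRep (A₁ × A₂))
    ((univRep A₁).comp (StarAlgHom.fst ℂ A₁ A₂)) ((univRep A₂).comp (StarAlgHom.snd ℂ A₁ A₂))
    (fun a h₁ h₂ => Prod.ext ((map_eq_zero_iff _ univRep_injective).mp h₁)
      ((map_eq_zero_iff _ univRep_injective).mp h₂)) (univRep C) d
  have h₁ := tensorRep_map (univRep A₁) (univRep C) (StarAlgHom.fst ℂ A₁ A₂) (StarAlgHom.id ℂ C) d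
  have h₂ := tensorRep_map (univRep A₂) (univRep C) (StarAlgHom.snd ℂ A₁ A₂) (StarAlgHom.id ℂ C) d
  rw [StarAlgHom.comp_id] at h₁ h₂
  rw [← h₁, ← h₂] at h
  simp only [← norm_algToSpatial] at h
  exact h

theorem star_algToProd_tmul (a : A₁ × A₂) (c : C) :
    algToProd A₁ A₂ C (star a ⊗ₜ star c) = star (algToProd A₁ A₂ C (a ⊗ₜ c)) := by
  rw [algToProd_tmul, algToProd_tmul]
  ext
  · exact (star_stmul a.1 c).symm
  · exact (star_stmul a.2 c).symm

theorem exists_star_algToProd (d : (A₁ × A₂) ⊗[ℂ] C) :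
    ∃ d', algToProd A₁ A₂ C d' = star (algToProd A₁ A₂ C d) ∧
      algToSpatial (A₁ × A₂) C d' = star (algToSpatial (A₁ × A₂) C d) := by
  refine ⟨star d, ?_, map_star _ d⟩
  induction d with
  | zero => simp only [star_zero, map_zero]
  | add x y hx hy => simp only [star_add, map_add, hx, hy]
  | tmul a c => exact star_algToProd_tmul a c

variable (A₁ A₂ C)

theorem exists_spatialProd :
    ∃ h : SpatialTensor A₁ C × SpatialTensor A₂ C →⋆ₐ[ℂ] SpatialTensor (A₁ × A₂) C,
      ∀ d, h (algToProd A₁ A₂ C d) = algToSpatial (A₁ × A₂) C d := by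
  have hd : DenseRange (algToProd A₁ A₂ C) := denseRange_algToProd
  have h := exists_starAlgHom_prod_of_norm_le (algToProd A₁ A₂ C)
    (algToSpatial (A₁ × A₂) C).toAlgHom
  exact h hd norm_algToSpatial_prod_le exists_star_algToProd

/-- The ⋆-homomorphism `(A₁ ⊗ C) × (A₂ ⊗ C) → (A₁ × A₂) ⊗ C`. -/
def spatialProd :
    SpatialTensor A₁ C × SpatialTensor A₂ C →⋆ₐ[ℂ] SpatialTensor (A₁ × A₂) C :=
  (exists_spatialProd A₁ A₂ C).choose

variable {A₁ A₂ C}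

theorem spatialProd_stmul_left (a : A₁) (c : C) :
    spatialProd A₁ A₂ C (stmul a c, 0) = stmul (a, 0) c := by
  have h := (exists_spatialProd A₁ A₂ C).choose_spec ((a, 0) ⊗ₜ c)
  rwa [algToProd_tmul, stmul_zero_left] at h

theorem spatialProd_stmul_right (a : A₂) (c : C) :
    spatialProd A₁ A₂ C (0, stmul a c) = stmul (0, a) c := by
  have h := (exists_spatialProd A₁ A₂ C).choose_spec ((0, a) ⊗ₜ c)
  rwa [algToProd_tmul, stmul_zero_left] at h

end ProdMap

end QuantumMaps

namespace QuantumMaps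

attribute [local irreducible] instCStarAlgebraSpatialTensor

/-! ### Exchanging the inner factors of a four-fold tensor product -/

section Shuffle

theorem tensorTensor_induction {M N P Q : Type*} [AddCommGroup M] [Module ℂ M] [AddCommGroup N]
    [Module ℂ N] [AddCommGroup P] [Module ℂ P] [AddCommGroup Q] [Module ℂ Q]
    {p : (M ⊗[ℂ] N) ⊗[ℂ] (P ⊗[ℂ] Q) → Prop} (zero : p 0)
    (tmul : ∀ a b c d, p ((a ⊗ₜ b) ⊗ₜ (c ⊗ₜ d))) (add : ∀ x y, p x → p y → p (x + y))
    (x : (M ⊗[ℂ] N) ⊗[ℂ] (P ⊗[ℂ] Q)) : p x := by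
  induction x with
  | zero => exact zero
  | add x y hx hy => exact add x y hx hy
  | tmul u v =>
    induction u with
    | zero => rw [TensorProduct.zero_tmul]; exact zero
    | add x y hx hy => rw [TensorProduct.add_tmul]; exact add _ _ hx hy
    | tmul a b =>
      induction v with
      | zero => rw [TensorProduct.tmul_zero]; exact zero
      | add x y hx hy => rw [TensorProduct.tmul_add]; exact add _ _ hx hy
      | tmul c d => exact tmul a b c d

section HilbertShuffle

variable {H₁ K₁ H₂ K₂ : Type*} [NormedAddCommGroup H₁] [InnerProductSpace ℂ H₁]
  [NormedAddCommGroup K₁] [InnerProductSpace ℂ K₁]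
  [NormedAddCommGroup H₂] [InnerProductSpace ℂ H₂]
  [NormedAddCommGroup K₂] [InnerProductSpace ℂ K₂]

variable (H₁ K₁ H₂ K₂) in
/-- The embedding of the algebraic tensor product of four Hilbert spaces. -/
def toHilbertTensor₄ : (H₁ ⊗[ℂ] K₁) ⊗[ℂ] (H₂ ⊗[ℂ] K₂) →ₗ[ℂ]
    HilbertTensor (HilbertTensor H₁ K₁) (HilbertTensor H₂ K₂) :=
  (toHilbertTensor _ _).toLinearMap ∘ₗ TensorProduct.map (toHilbertTensor H₁ K₁).toLinearMap
    (toHilbertTensor H₂ K₂).toLinearMap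

theorem toHilbertTensor₄_tmul (x₁ : H₁) (y₁ : K₁) (x₂ : H₂) (y₂ : K₂) :
    toHilbertTensor₄ H₁ K₁ H₂ K₂ ((x₁ ⊗ₜ y₁) ⊗ₜ (x₂ ⊗ₜ y₂)) =
      toHilbertTensor _ _ (toHilbertTensor H₁ K₁ (x₁ ⊗ₜ y₁) ⊗ₜ
        toHilbertTensor H₂ K₂ (x₂ ⊗ₜ y₂)) := rfl

/-- On elementary tensors both sides are the product of the same four inner products. -/
theorem inner_toHilbertTensor₄ (x y : (H₁ ⊗[ℂ] K₁) ⊗[ℂ] (H₂ ⊗[ℂ] K₂)) :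
    ⟪toHilbertTensor₄ H₁ H₂ K₁ K₂ (TensorProduct.tensorTensorTensorComm ℂ H₁ K₁ H₂ K₂ x),
      toHilbertTensor₄ H₁ H₂ K₁ K₂ (TensorProduct.tensorTensorTensorComm ℂ H₁ K₁ H₂ K₂ y)⟫_ℂ =
    ⟪toHilbertTensor₄ H₁ K₁ H₂ K₂ x, toHilbertTensor₄ H₁ K₁ H₂ K₂ y⟫_ℂ := by
  induction x using tensorTensor_induction with
  | zero => simp only [map_zero, inner_zero_left]
  | add x x' hx hx' => simp only [map_add, inner_add_left, hx, hx']
  | tmul a b c d =>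
    induction y using tensorTensor_induction with
    | zero => simp only [map_zero, inner_zero_right]
    | add x x' hx hx' => simp only [map_add, inner_add_right, hx, hx']
    | tmul a' b' c' d' =>
      simp only [TensorProduct.tensorTensorTensorComm_tmul, toHilbertTensor₄_tmul,
        inner_toHilbertTensor_tmul]
      ring

theorem denseRange_toHilbertTensor₄ : DenseRange (toHilbertTensor₄ H₁ K₁ H₂ K₂) :=
  denseRange_comp_map (toHilbertTensor _ _).toLinearMap (denseRange_toHilbertTensor _ _)
    ((toHilbertTensor _ _).continuous.comp TensorProduct.continuous_tmul)
    (toHilbertTensor H₁ K₁).toLinearMap (denseRange_toHilbertTensor _ _)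
    (toHilbertTensor H₂ K₂).toLinearMap (denseRange_toHilbertTensor _ _)

end HilbertShuffle

theorem norm_le_of_shuffle {A₁ C₁ A₂ C₂ H₁ K₁ H₂ K₂ : Type*}
    [CStarAlgebra A₁] [CStarAlgebra C₁] [CStarAlgebra A₂] [CStarAlgebra C₂]
    [NormedAddCommGroup H₁] [InnerProductSpace ℂ H₁] [NormedAddCommGroup K₁]
    [InnerProductSpace ℂ K₁] [NormedAddCommGroup H₂] [InnerProductSpace ℂ H₂]
    [NormedAddCommGroup K₂] [InnerProductSpace ℂ K₂]
    (ρ₁ : A₁ → (H₁ →L[ℂ] H₁)) (σ₁ : C₁ → (K₁ →L[ℂ] K₁))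
    (ρ₂ : A₂ → (H₂ →L[ℂ] H₂)) (σ₂ : C₂ → (K₂ →L[ℂ] K₂))
    (Φ : (A₁ ⊗[ℂ] C₁) ⊗[ℂ] (A₂ ⊗[ℂ] C₂) →ₗ[ℂ]
      (HilbertTensor (HilbertTensor H₁ K₁) (HilbertTensor H₂ K₂) →L[ℂ]
        HilbertTensor (HilbertTensor H₁ K₁) (HilbertTensor H₂ K₂)))
    (Φ' : (A₁ ⊗[ℂ] C₁) ⊗[ℂ] (A₂ ⊗[ℂ] C₂) →ₗ[ℂ]
      (HilbertTensor (HilbertTensor H₁ H₂) (HilbertTensor K₁ K₂) →L[ℂ]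
        HilbertTensor (HilbertTensor H₁ H₂) (HilbertTensor K₁ K₂)))
    (hΦ : ∀ a₁ c₁ a₂ c₂, Φ ((a₁ ⊗ₜ c₁) ⊗ₜ (a₂ ⊗ₜ c₂)) =
      opTensor (opTensor (ρ₁ a₁) (σ₁ c₁)) (opTensor (ρ₂ a₂) (σ₂ c₂)))
    (hΦ' : ∀ a₁ c₁ a₂ c₂, Φ' ((a₁ ⊗ₜ c₁) ⊗ₜ (a₂ ⊗ₜ c₂)) =
      opTensor (opTensor (ρ₁ a₁) (ρ₂ a₂)) (opTensor (σ₁ c₁) (σ₂ c₂)))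
    (x : (A₁ ⊗[ℂ] C₁) ⊗[ℂ] (A₂ ⊗[ℂ] C₂)) : ‖Φ' x‖ ≤ ‖Φ x‖ := by
  let E := toHilbertTensor₄ H₁ K₁ H₂ K₂
  let E' := toHilbertTensor₄ H₁ H₂ K₁ K₂ ∘ₗ
    (TensorProduct.tensorTensorTensorComm ℂ H₁ K₁ H₂ K₂).toLinearMap
  have hE' : DenseRange E' := by
    have hs : Set.range E' = Set.range (toHilbertTensor₄ H₁ H₂ K₁ K₂) := by
      rw [LinearMap.coe_comp]
      exact (TensorProduct.tensorTensorTensorComm ℂ H₁ K₁ H₂ K₂).surjective.range_comp _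
    intro ζ
    rw [hs]
    exact denseRange_toHilbertTensor₄ ζ
  have hn : ∀ v, ‖E' v‖ = ‖E v‖ := fun v => by
    rw [@norm_eq_sqrt_re_inner ℂ, @norm_eq_sqrt_re_inner ℂ]
    exact congrArg (fun z => √(RCLike.re z)) (inner_toHilbertTensor₄ v v)
  refine norm_le_norm_of_intertwine E E' hE' hn _ _ fun v => ?_
  induction x using tensorTensor_induction with
  | zero => exact ⟨0, by rw [map_zero, map_zero]; rfl, by rw [map_zero, map_zero]; rfl⟩
  | add x y hx hy =>
    obtain ⟨⟨v₁, h₁, h₁'⟩, v₂, h₂, h₂'⟩ := And.intro hx hy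
    exact ⟨v₁ + v₂, by rw [map_add, map_add, add_apply, h₁, h₂],
      by rw [map_add, map_add, add_apply, h₁', h₂']⟩
  | tmul a₁ c₁ a₂ c₂ =>
    induction v using tensorTensor_induction with
    | zero => exact ⟨0, by simp only [map_zero], by simp only [map_zero]⟩
    | add x y hx hy =>
      obtain ⟨⟨v₁, h₁, h₁'⟩, v₂, h₂, h₂'⟩ := And.intro hx hy
      exact ⟨v₁ + v₂, by simp only [map_add, h₁, h₂], by simp only [map_add, h₁', h₂']⟩
    | tmul x₁ y₁ x₂ y₂ =>
      refine ⟨(ρ₁ a₁ x₁ ⊗ₜ σ₁ c₁ y₁) ⊗ₜ (ρ₂ a₂ x₂ ⊗ₜ σ₂ c₂ y₂), ?_, ?_⟩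
      · rw [hΦ]
        refine (opTensor_tmul _ _ _ _).trans ?_
        exact congrArg (toHilbertTensor _ _) (congrArg₂ (· ⊗ₜ[ℂ] ·) (opTensor_tmul _ _ _ _)
          (opTensor_tmul _ _ _ _))
      · rw [hΦ']
        refine (opTensor_tmul _ _ _ _).trans ?_
        exact congrArg (toHilbertTensor _ _) (congrArg₂ (· ⊗ₜ[ℂ] ·) (opTensor_tmul _ _ _ _)
          (opTensor_tmul _ _ _ _))

variable (A₁ C₁ A₂ C₂ : Type*)
  [CStarAlgebra A₁] [PartialOrder A₁] [StarOrderedRing A₁]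
  [CStarAlgebra C₁] [PartialOrder C₁] [StarOrderedRing C₁]
  [CStarAlgebra A₂] [PartialOrder A₂] [StarOrderedRing A₂]
  [CStarAlgebra C₂] [PartialOrder C₂] [StarOrderedRing C₂]

/-- The canonical homomorphism of the algebraic tensor product of four algebras. -/
def algToSpatial₄ : (A₁ ⊗[ℂ] C₁) ⊗[ℂ] (A₂ ⊗[ℂ] C₂) →ₐ[ℂ]
    SpatialTensor (SpatialTensor A₁ C₁) (SpatialTensor A₂ C₂) :=
  (algToSpatial _ _).toAlgHom.comp
    (Algebra.TensorProduct.map (algToSpatial A₁ C₁).toAlgHom (algToSpatial A₂ C₂).toAlgHom)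

variable {A₁ C₁ A₂ C₂}

theorem algToSpatial₄_tmul (a₁ : A₁) (c₁ : C₁) (a₂ : A₂) (c₂ : C₂) :
    algToSpatial₄ A₁ C₁ A₂ C₂ ((a₁ ⊗ₜ c₁) ⊗ₜ (a₂ ⊗ₜ c₂)) =
      stmul (stmul a₁ c₁) (stmul a₂ c₂) := rfl

theorem algToSpatial₄_apply (x : (A₁ ⊗[ℂ] C₁) ⊗[ℂ] (A₂ ⊗[ℂ] C₂)) :
    algToSpatial₄ A₁ C₁ A₂ C₂ x = algToSpatial _ _ (TensorProduct.map (algToSpatialLinear A₁ C₁)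
      (algToSpatialLinear A₂ C₂) x) := rfl

theorem denseRange_algToSpatial₄ : DenseRange (algToSpatial₄ A₁ C₁ A₂ C₂) := by
  have h : DenseRange (algToSpatialLinear (SpatialTensor A₁ C₁) (SpatialTensor A₂ C₂)) :=
    denseRange_algToSpatial _ _
  have h₁ : DenseRange (algToSpatialLinear A₁ C₁) := denseRange_algToSpatial A₁ C₁
  have h₂ : DenseRange (algToSpatialLinear A₂ C₂) := denseRange_algToSpatial A₂ C₂
  have h₃ := denseRange_comp_map _ h continuous_stmul _ h₁ _ h₂
  exact h₃

theorem norm_algToSpatial₄_shuffle_le (x : (A₁ ⊗[ℂ] C₁) ⊗[ℂ] (A₂ ⊗[ℂ] C₂)) :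
    ‖algToSpatial₄ A₁ A₂ C₁ C₂ (TensorProduct.tensorTensorTensorComm ℂ A₁ C₁ A₂ C₂ x)‖ ≤
      ‖algToSpatial₄ A₁ C₁ A₂ C₂ x‖ := by
  let Φ := (tensorRep (spatialInclusion A₁ C₁) (spatialInclusion A₂ C₂)).toAlgHom.toLinearMap ∘ₗ
    TensorProduct.map (algToSpatialLinear A₁ C₁) (algToSpatialLinear A₂ C₂)
  let Φ' := (tensorRep (spatialInclusion A₁ A₂) (spatialInclusion C₁ C₂)).toAlgHom.toLinearMap ∘ₗ
    TensorProduct.map (algToSpatialLinear A₁ A₂) (algToSpatialLinear C₁ C₂) ∘ₗ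
    (TensorProduct.tensorTensorTensorComm ℂ A₁ C₁ A₂ C₂).toLinearMap
  have h := norm_le_of_shuffle (univRep A₁) (univRep C₁) (univRep A₂) (univRep C₂) Φ Φ'
    (fun a₁ c₁ a₂ c₂ => congrArg₂ opTensor (spatialInclusion_algToSpatial (a₁ ⊗ₜ c₁))
      (spatialInclusion_algToSpatial (a₂ ⊗ₜ c₂)))
    (fun a₁ c₁ a₂ c₂ => congrArg₂ opTensor (spatialInclusion_algToSpatial (a₁ ⊗ₜ a₂))
      (spatialInclusion_algToSpatial (c₁ ⊗ₜ c₂))) x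
  rw [algToSpatial₄_apply, algToSpatial₄_apply]
  -- The concrete inclusions of the inner tensor products are faithful, so they may replace the
  -- universal representations; on the resulting Hilbert spaces the shuffle is explicit.
  exact (norm_algToSpatial_le _ spatialInclusion_injective _ spatialInclusion_injective _).trans
    (h.trans (norm_tensorRep_le _ _ _))

variable (A₁ C₁ A₂ C₂)

theorem exists_spatialShuffle :
    ∃ h : SpatialTensor (SpatialTensor A₁ C₁) (SpatialTensor A₂ C₂) →⋆ₐ[ℂ]
        SpatialTensor (SpatialTensor A₁ A₂) (SpatialTensor C₁ C₂),
      ∀ a₁ c₁ a₂ c₂, h (stmul (stmul a₁ c₁) (stmul a₂ c₂)) =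
        stmul (stmul a₁ a₂) (stmul c₁ c₂) := by
  let s := (Algebra.TensorProduct.tensorTensorTensorComm ℂ ℂ ℂ ℂ A₁ C₁ A₂ C₂).toAlgHom
  obtain ⟨h, hh⟩ := exists_starAlgHom_of_norm_le (algToSpatial₄ A₁ C₁ A₂ C₂)
    ((algToSpatial₄ A₁ A₂ C₁ C₂).comp s) denseRange_algToSpatial₄ norm_algToSpatial₄_shuffle_le
    (fun d => by
      induction d using tensorTensor_induction with
      | zero => exact ⟨0, by simp⟩
      | add x y hx hy =>
        obtain ⟨⟨v₁, h₁, h₁'⟩, v₂, h₂, h₂'⟩ := And.intro hx hy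
        exact ⟨v₁ + v₂, by simp only [map_add, star_add, h₁, h₂],
          by simp only [map_add, star_add, h₁', h₂']⟩
      | tmul a b c d =>
        refine ⟨(star a ⊗ₜ star b) ⊗ₜ (star c ⊗ₜ star d), ?_, ?_⟩
        · rw [algToSpatial₄_tmul, algToSpatial₄_tmul, star_stmul, star_stmul, star_stmul]
        · change algToSpatial₄ A₁ A₂ C₁ C₂ ((star a ⊗ₜ star c) ⊗ₜ (star b ⊗ₜ star d)) =
            star (algToSpatial₄ A₁ A₂ C₁ C₂ ((a ⊗ₜ c) ⊗ₜ (b ⊗ₜ d)))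
          rw [algToSpatial₄_tmul, algToSpatial₄_tmul, star_stmul, star_stmul, star_stmul])
  exact ⟨h, fun a₁ c₁ a₂ c₂ => hh ((a₁ ⊗ₜ c₁) ⊗ₜ (a₂ ⊗ₜ c₂))⟩

/-- The ⋆-homomorphism `(A₁ ⊗ C₁) ⊗ (A₂ ⊗ C₂) → (A₁ ⊗ A₂) ⊗ (C₁ ⊗ C₂)` exchanging the two inner
factors. -/
def spatialShuffle : SpatialTensor (SpatialTensor A₁ C₁) (SpatialTensor A₂ C₂) →⋆ₐ[ℂ]
    SpatialTensor (SpatialTensor A₁ A₂) (SpatialTensor C₁ C₂) :=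
  (exists_spatialShuffle A₁ C₁ A₂ C₂).choose

variable {A₁ C₁ A₂ C₂}

theorem spatialShuffle_stmul (a₁ : A₁) (c₁ : C₁) (a₂ : A₂) (c₂ : C₂) :
    spatialShuffle A₁ C₁ A₂ C₂ (stmul (stmul a₁ c₁) (stmul a₂ c₂)) =
      stmul (stmul a₁ a₂) (stmul c₁ c₂) :=
  (exists_spatialShuffle A₁ C₁ A₂ C₂).choose_spec a₁ c₁ a₂ c₂

end Shuffle

end QuantumMaps

namespace QuantumMaps

attribute [local irreducible] instCStarAlgebraSpatialTensor

/-! ### Positivity and complete positivity of slice maps -/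

section Positivity

theorem eq_zero_of_isSelfAdjoint_of_cube {A : Type*} [NonUnitalCStarAlgebra A] {n : A}
    (hn : IsSelfAdjoint n) (h : n * n * n = 0) : n = 0 := by
  have h2 : IsSelfAdjoint (n * n) := by
    have := IsSelfAdjoint.star_mul_self n
    rwa [hn.star_eq] at this
  have h4 : (n * n) * (n * n) = 0 := by rw [← mul_assoc, h, zero_mul]
  have h5 : n * n = 0 := by
    rw [← CStarRing.star_mul_self_eq_zero_iff, h2.star_eq, h4]
  rw [← CStarRing.star_mul_self_eq_zero_iff, hn.star_eq, h5]

/-- An injective ⋆-homomorphism of C⋆-algebras reflects positivity. -/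
theorem nonneg_of_map_nonneg {A B : Type*} [NonUnitalCStarAlgebra A] [PartialOrder A]
    [StarOrderedRing A] [NonUnitalCStarAlgebra B] [PartialOrder B] [StarOrderedRing B]
    (φ : A →⋆ₙₐ[ℂ] B) (hφ : Function.Injective φ) {a : A} (ha : 0 ≤ φ a) : 0 ≤ a := by
  have hsa : IsSelfAdjoint a := hφ (by rw [map_star, (IsSelfAdjoint.of_nonneg ha).star_eq])
  have hn : 0 ≤ a⁻ := CFC.negPart_nonneg a
  have hnsa : IsSelfAdjoint (a⁻) := .of_nonneg hn
  have hpn : a⁻ * a⁺ = 0 := CFC.negPart_mul_posPart a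
  have hsub : a⁺ - a⁻ = a := CFC.posPart_sub_negPart a hsa
  -- With `n = a⁻`, the image of `n a n = -n³` is positive because that of `a` is, while the image
  -- of `n³` is positive because `n` is. Hence `n³ = 0`, so `n = 0`.
  have h1 : a⁻ * a * a⁻ = -(a⁻ * a⁻ * a⁻) := by
    have h0 : a⁻ * a = a⁻ * (a⁺ - a⁻) := by rw [hsub]
    rw [h0, mul_sub, hpn, zero_sub, neg_mul]
  have h2 : 0 ≤ φ (a⁻ * a * a⁻) := by
    rw [map_mul, map_mul]
    exact (hnsa.map φ).conjugate_nonneg ha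
  have h3 : 0 ≤ φ (a⁻ * a⁻ * a⁻) := by
    rw [map_mul, map_mul]
    exact (hnsa.map φ).conjugate_nonneg (map_nonneg φ hn)
  rw [h1, map_neg, neg_nonneg] at h2
  have h4 : a⁻ * a⁻ * a⁻ = 0 := (map_eq_zero_iff φ hφ).mp (le_antisymm h2 h3)
  rw [← hsub, eq_zero_of_isSelfAdjoint_of_cube hnsa h4, sub_zero]
  exact CFC.posPart_nonneg a

end Positivity

section Corner

variable {A H K : Type*} [CStarAlgebra A] [NormedAddCommGroup H] [InnerProductSpace ℂ H]
  [CompleteSpace H] [NormedAddCommGroup K] [InnerProductSpace ℂ K]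

/-- The projection `1 ⊗ |η⟩⟨η|` on the Hilbert space tensor product. -/
def cornerProj (H : Type*) [NormedAddCommGroup H] [InnerProductSpace ℂ H] [CompleteSpace H]
    (η : K) : HilbertTensor H K →L[ℂ] HilbertTensor H K :=
  tensorRight η ∘L ContinuousLinearMap.adjoint (tensorRight η)

theorem star_cornerProj (η : K) : star (cornerProj H η) = cornerProj H η := by
  rw [cornerProj, ContinuousLinearMap.star_eq_adjoint, ContinuousLinearMap.adjoint_comp,
    ContinuousLinearMap.adjoint_adjoint]

/-- The non-unital representation `a ↦ ρ a ⊗ |η⟩⟨η|`. -/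
def cornerRep (ρ : A →⋆ₐ[ℂ] (H →L[ℂ] H)) {η : K} (hη : ‖η‖ = 1) :
    A →⋆ₙₐ[ℂ] (HilbertTensor H K →L[ℂ] HilbertTensor H K) where
  toFun a := tensorRight η ∘L ρ a ∘L ContinuousLinearMap.adjoint (tensorRight η)
  map_smul' r a := by simp
  map_zero' := by simp
  map_add' a b := by simp
  map_mul' a b := by
    have h : ContinuousLinearMap.adjoint (tensorRight η) ∘L tensorRight η = (1 : H →L[ℂ] H) := by
      rw [adjoint_tensorRight_comp_tensorRight, inner_self_eq_norm_sq_to_K, hη]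
      simp
    ext1 ζ
    have h' := congrArg (fun T : H →L[ℂ] H =>
      tensorRight η (ρ a (T (ρ b (ContinuousLinearMap.adjoint (tensorRight η) ζ))))) h
    rw [map_mul]
    exact h'.symm
  map_star' a := by
    rw [map_star, ContinuousLinearMap.star_eq_adjoint, ContinuousLinearMap.star_eq_adjoint,
      ContinuousLinearMap.adjoint_comp, ContinuousLinearMap.adjoint_comp,
      ContinuousLinearMap.adjoint_adjoint, ContinuousLinearMap.comp_assoc]

theorem cornerRep_apply (ρ : A →⋆ₐ[ℂ] (H →L[ℂ] H)) {η : K} (hη : ‖η‖ = 1) (a : A) :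
    cornerRep ρ hη a =
      tensorRight η ∘L ρ a ∘L ContinuousLinearMap.adjoint (tensorRight η) := rfl

theorem cornerRep_injective (ρ : A →⋆ₐ[ℂ] (H →L[ℂ] H)) (hρ : Function.Injective ρ) {η : K}
    (hη : ‖η‖ = 1) : Function.Injective (cornerRep ρ hη) := by
  rw [injective_iff_map_eq_zero]
  intro a ha
  refine (map_eq_zero_iff ρ hρ).mp ?_
  ext y
  have h := congrArg (fun T => ContinuousLinearMap.adjoint (tensorRight η)
    (T (tensorRight η y))) ha
  simpa [cornerRep_apply, tensorRight_apply, adjoint_tensorRight_tmul, inner_self_eq_norm_sq_to_K,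
    hη] using h

end Corner

section SliceCP

variable {A C : Type*} [CStarAlgebra A] [PartialOrder A] [StarOrderedRing A]
  [CStarAlgebra C] [PartialOrder C] [StarOrderedRing C]

theorem univRep_slice (ν : State C) (y : SpatialTensor A C) :
    univRep A (slice A ν y) = compressRight (cyclicVector ν) (spatialInclusion A C y) := by
  have hc : Continuous (compressRight (H := UnivSpace A) (cyclicVector ν)) :=
    ((compressRight (H := UnivSpace A) (cyclicVector ν)).mkContinuous 1 fun S =>
      (norm_compressRight_le _ (norm_cyclicVector ν) S).trans_eq (one_mul _).symm).continuous
  refine (denseRange_algToSpatial A C).induction_on y (isClosed_eq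
    ((map_continuous (univRep A)).comp (slice A ν).continuous)
    (hc.comp (map_continuous (spatialInclusion A C)))) fun x => ?_
  rw [slice_algToSpatial, univRep_algSlice, spatialInclusion_algToSpatial]

/-- Since the slice is `V⋆ y V`, conjugating back by `V` gives `p y p` with `p = V V⋆`. This keeps
everything in the operators on a single Hilbert space. -/
theorem cornerRep_slice (ν : State C) (y : SpatialTensor A C) :
    cornerRep (univRep A) (norm_cyclicVector ν) (slice A ν y) =
      cornerProj _ (cyclicVector ν) * spatialInclusion A C y * cornerProj _ (cyclicVector ν) := by
  rw [cornerRep_apply, univRep_slice]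
  rfl

theorem slice_one (ν : State C) : slice A ν 1 = 1 := by
  rw [← stmul_one_one, slice_stmul, ν.2, one_smul]

theorem diagonal_mul_mul_diagonal_apply {n R : Type*} [Fintype n] [DecidableEq n] [Semiring R]
    (p : R) (N : Matrix n n R) (i j : n) :
    (Matrix.diagonal (fun _ => p) * N * Matrix.diagonal (fun _ => p) : Matrix n n R) i j = p * N i j * p := by
  rw [Matrix.mul_diagonal, Matrix.diagonal_mul]

/-- The slice map as a completely positive map. -/
def sliceCP (A : Type*) [CStarAlgebra A] [PartialOrder A] [StarOrderedRing A] (ν : State C) :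
    CompletelyPositiveMap (SpatialTensor A C) A where
  toLinearMap := (slice A ν : SpatialTensor A C →ₗ[ℂ] A)
  map_cstarMatrix_nonneg' k M hM := by
    -- Positivity is reflected by the entrywise corner representation, under which the sliced matrix
    -- becomes `D M D` with `D` the diagonal matrix of corner projections.
    have hj : Function.Injective (CStarMatrix.mapₙₐ (n := Fin k)
        (cornerRep (univRep A) (norm_cyclicVector ν))) := fun M N h =>
      CStarMatrix.map_injective
        (cornerRep_injective _ univRep_injective (norm_cyclicVector ν)) h
    refine nonneg_of_map_nonneg _ hj ?_
    have hι : 0 ≤ CStarMatrix.mapₙₐ (n := Fin k)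
        (spatialInclusion A C).toNonUnitalStarAlgHom M := map_nonneg _ hM
    let D : CStarMatrix (Fin k) (Fin k) (HilbertTensor (UnivSpace A) (UnivSpace C) →L[ℂ]
        HilbertTensor (UnivSpace A) (UnivSpace C)) :=
      CStarMatrix.ofMatrix (Matrix.diagonal fun _ => cornerProj (UnivSpace A) (cyclicVector ν))
    have hD : IsSelfAdjoint D := by
      ext1 i j
      change star (Matrix.diagonal (fun _ => cornerProj (UnivSpace A) (cyclicVector ν)) j i) =
        Matrix.diagonal (fun _ => cornerProj (UnivSpace A) (cyclicVector ν)) i j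
      rcases eq_or_ne i j with rfl | hij
      · simp only [Matrix.diagonal_apply_eq, star_cornerProj]
      · simp only [Matrix.diagonal_apply_ne _ hij, Matrix.diagonal_apply_ne' _ hij, star_zero]
    convert! hD.conjugate_nonneg hι
    ext1 i j
    refine (cornerRep_slice ν (M i j)).trans ?_
    exact (diagonal_mul_mul_diagonal_apply (cornerProj (UnivSpace A) (cyclicVector ν))
      (fun i j => spatialInclusion A C (M i j)) i j).symm

theorem slice_nonneg (ν : State C) {y : SpatialTensor A C} (hy : 0 ≤ y) : 0 ≤ slice A ν y :=
  map_nonneg (sliceCP A ν) hy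

end SliceCP

section Operator

variable {A B C : Type*} [CStarAlgebra A] [PartialOrder A] [StarOrderedRing A]
  [CStarAlgebra B] [PartialOrder B] [StarOrderedRing B]
  [CStarAlgebra C] [PartialOrder C] [StarOrderedRing C]

/-- The operator of a random quantum map is a Feller-Markov operator. -/
theorem exists_implementedBy (R : RandomQuantumMap.{w} B A) :
    ∃ F : FellerMarkov B A, (∀ b, F b = R.operator b) ∧ FellerMarkov.Implemented.{w} F := by
  let F : FellerMarkov B A :=
    { toLinearMap := (slice A R.ν : SpatialTensor A R.C →ₗ[ℂ] A) ∘ₗ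
        (R.φ : B →ₗ[ℂ] SpatialTensor A R.C)
      map_cstarMatrix_nonneg' := fun k M hM =>
        (sliceCP A R.ν).map_cstarMatrix_nonneg' k _
          (CompletelyPositiveMapClass.map_cstarMatrix_nonneg' R.φ k M hM)
      map_one' := (congrArg (slice A R.ν) (map_one R.φ)).trans (slice_one R.ν) }
  exact ⟨F, fun b => rfl, R, fun b => rfl⟩

/-- The product state `ν₁ ⊗ ν₂`. -/
def prodState (ν₁ : State A) (ν₂ : State C) : State (SpatialTensor A C) :=
  -- Slicing by `ν₂` and then applying `ν₁` makes positivity immediate from that of the slice.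
  ⟨PositiveLinearMap.mk₀ ((ν₁.1 : A →ₗ[ℂ] ℂ) ∘ₗ (slice A ν₂ : SpatialTensor A C →ₗ[ℂ] A))
    fun _ hy => map_nonneg ν₁.1 (slice_nonneg ν₂ hy),
    (congrArg ν₁.1 (slice_one ν₂)).trans ν₁.2⟩

theorem prodState_stmul (ν₁ : State A) (ν₂ : State C) (a : A) (c : C) :
    (prodState ν₁ ν₂).1 (stmul a c) = ν₁.1 a * ν₂.1 c := by
  change ν₁.1 (slice A ν₂ (stmul a c)) = _
  rw [slice_stmul, map_smul, smul_eq_mul, mul_comm]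

end Operator

end QuantumMaps

namespace QuantumMaps

attribute [local irreducible] instCStarAlgebraSpatialTensor

/-! ### Slices of the structural morphisms -/

section SliceFormulas

/-- A ⋆-homomorphism of C⋆-algebras as a continuous linear map. -/
def starHomCLM {X Y : Type*} [CStarAlgebra X] [CStarAlgebra Y] (f : X →⋆ₐ[ℂ] Y) : X →L[ℂ] Y where
  toFun := f
  map_add' := map_add f
  map_smul' := map_smul f
  cont := map_continuous f

variable {A C X Y A₁ C₁ A₂ C₂ : Type*}
  [CStarAlgebra A] [PartialOrder A] [StarOrderedRing A]
  [CStarAlgebra C] [PartialOrder C] [StarOrderedRing C]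
  [CStarAlgebra X] [PartialOrder X] [StarOrderedRing X]
  [CStarAlgebra Y] [PartialOrder Y] [StarOrderedRing Y]
  [CStarAlgebra A₁] [PartialOrder A₁] [StarOrderedRing A₁]
  [CStarAlgebra C₁] [PartialOrder C₁] [StarOrderedRing C₁]
  [CStarAlgebra A₂] [PartialOrder A₂] [StarOrderedRing A₂]
  [CStarAlgebra C₂] [PartialOrder C₂] [StarOrderedRing C₂]

theorem slice_spatialMap (f : A →⋆ₐ[ℂ] X) (g : C →⋆ₐ[ℂ] Y) (ν : State C) (ν' : State Y)
    (h : ∀ c, ν'.1 (g c) = ν.1 c) (z : SpatialTensor A C) :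
    slice X ν' (spatialMap f g z) = f (slice A ν z) := by
  have key : (slice X ν').comp (starHomCLM (spatialMap f g)) = (starHomCLM f).comp (slice A ν) :=
    spatial_clm_ext fun a c => by
      change slice X ν' (spatialMap f g (stmul a c)) = f (slice A ν (stmul a c))
      rw [spatialMap_stmul, slice_stmul, slice_stmul, h, map_smul]
  exact DFunLike.congr_fun key z

theorem smul_stmul_smul (r s : ℂ) (a : A) (c : C) : stmul (r • a) (s • c) = (r * s) • stmul a c := by
  simp only [stmul, TensorProduct.smul_tmul_smul]
  exact map_smul (algToSpatial A C) _ _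

/-- Both sides are bounded and linear in `x` and in `y` separately, so each variable is reduced to
elementary tensors in turn. -/
theorem slice_spatialShuffle (ν₁ : State C₁) (ν₂ : State C₂) (x : SpatialTensor A₁ C₁)
    (y : SpatialTensor A₂ C₂) :
    slice (SpatialTensor A₁ A₂) (prodState ν₁ ν₂) (spatialShuffle A₁ C₁ A₂ C₂ (stmul x y)) =
      stmul (slice A₁ ν₁ x) (slice A₂ ν₂ y) := by
  let S := (slice (SpatialTensor A₁ A₂) (prodState ν₁ ν₂)).comp
    (starHomCLM (spatialShuffle A₁ C₁ A₂ C₂))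
  have h₂ (a₁ : A₁) (c₁ : C₁) : S.comp (stmulL _ (SpatialTensor A₂ C₂) (stmul a₁ c₁)) =
      (stmulL A₁ A₂ (slice A₁ ν₁ (stmul a₁ c₁))).comp (slice A₂ ν₂) :=
    spatial_clm_ext fun a₂ c₂ => by
      change slice (SpatialTensor A₁ A₂) (prodState ν₁ ν₂)
        (spatialShuffle A₁ C₁ A₂ C₂ (stmul (stmul a₁ c₁) (stmul a₂ c₂))) =
          stmul (slice A₁ ν₁ (stmul a₁ c₁)) (slice A₂ ν₂ (stmul a₂ c₂))
      rw [spatialShuffle_stmul, slice_stmul, slice_stmul, slice_stmul, prodState_stmul,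
        smul_stmul_smul]
  have h₁ : S.comp ((stmulL (SpatialTensor A₁ C₁) (SpatialTensor A₂ C₂)).flip y) =
      ((stmulL A₁ A₂).flip (slice A₂ ν₂ y)).comp (slice A₁ ν₁) :=
    spatial_clm_ext fun a₁ c₁ => DFunLike.congr_fun (h₂ a₁ c₁) y
  exact DFunLike.congr_fun h₁ x

theorem slice_spatialProd (ν : State C) (x : SpatialTensor A₁ C) (y : SpatialTensor A₂ C) :
    slice (A₁ × A₂) ν (spatialProd A₁ A₂ C (x, y)) = (slice A₁ ν x, slice A₂ ν y) := by
  let S := (slice (A₁ × A₂) ν).comp (starHomCLM (spatialProd A₁ A₂ C))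
  have h₁ : S.comp (ContinuousLinearMap.inl ℂ _ _) =
      (ContinuousLinearMap.inl ℂ A₁ A₂).comp (slice A₁ ν) := spatial_clm_ext fun a c => by
    change slice (A₁ × A₂) ν (spatialProd A₁ A₂ C (stmul a c, 0)) = (slice A₁ ν (stmul a c), 0)
    rw [spatialProd_stmul_left, slice_stmul, slice_stmul, Prod.smul_mk, smul_zero]
  have h₂ : S.comp (ContinuousLinearMap.inr ℂ _ _) =
      (ContinuousLinearMap.inr ℂ A₁ A₂).comp (slice A₂ ν) := spatial_clm_ext fun a c => by
    change slice (A₁ × A₂) ν (spatialProd A₁ A₂ C (0, stmul a c)) = (0, slice A₂ ν (stmul a c))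
    rw [spatialProd_stmul_right, slice_stmul, slice_stmul, Prod.smul_mk, smul_zero]
  have h : S (x, y) = S (x, 0) + S (0, y) := by
    rw [← map_add, Prod.mk_add_mk, add_zero, zero_add]
  have hx : S (x, 0) = (slice A₁ ν x, 0) := DFunLike.congr_fun h₁ x
  have hy : S (0, y) = (0, slice A₂ ν y) := DFunLike.congr_fun h₂ y
  change S (x, y) = _
  rw [h, hx, hy, Prod.mk_add_mk, add_zero, zero_add]

end SliceFormulas

/-! ### Random quantum maps implementing the given operators -/

section Implemented

theorem exists_implemented_state (A : Type u) [CStarAlgebra A] [PartialOrder A] [StarOrderedRing A]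
    (σ : State A) :
    ∃ F : FellerMarkov A ℂ, (∀ a, F a = σ.1 a) ∧ FellerMarkov.Implemented.{u} F := by
  obtain ⟨F, hF, hI⟩ := exists_implementedBy ⟨A, spatialRight ℂ A, σ⟩
  refine ⟨F, fun a => (hF a).trans ?_, hI⟩
  change slice ℂ σ (spatialRight ℂ A a) = σ.1 a
  rw [spatialRight_apply, slice_stmul, smul_eq_mul, mul_one]

/-- Evaluation on a one-point space. -/
def pointState : State (PUnit.{w + 1} → ℂ) :=
  ⟨PositiveLinearMap.mk₀ (LinearMap.proj PUnit.unit) fun _ h => h PUnit.unit, rfl⟩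

variable {A₁ : Type u₁} [CStarAlgebra A₁] [PartialOrder A₁] [StarOrderedRing A₁]
  {A₂ : Type u₂} [CStarAlgebra A₂] [PartialOrder A₂] [StarOrderedRing A₂]
  {B₁ : Type u₃} [CStarAlgebra B₁] [PartialOrder B₁] [StarOrderedRing B₁]
  {B₂ : Type u₄} [CStarAlgebra B₂] [PartialOrder B₂] [StarOrderedRing B₂]

theorem exists_implemented_starAlgHom (φ : B₁ →⋆ₐ[ℂ] A₁) :
    ∃ F : FellerMarkov B₁ A₁, (∀ b, F b = φ b) ∧ FellerMarkov.Implemented.{w} F := by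
  obtain ⟨F, hF, hI⟩ := exists_implementedBy
    -- Functions on a point are a copy of `ℂ` available in every universe.
    ⟨PUnit.{w + 1} → ℂ, (spatialLeft A₁ (PUnit.{w + 1} → ℂ)).comp φ, pointState⟩
  refine ⟨F, fun b => (hF b).trans ?_, hI⟩
  change slice A₁ pointState (spatialLeft A₁ (PUnit.{w + 1} → ℂ) (φ b)) = φ b
  rw [spatialLeft_apply, slice_stmul, pointState.2, one_smul]

theorem exists_implemented_comp (F₁ : FellerMarkov A₂ A₁) (F₂ : FellerMarkov B₁ A₂)
    (h₁ : FellerMarkov.Implemented.{w₁} F₁) (h₂ : FellerMarkov.Implemented.{w₂} F₂) :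
    ∃ F : FellerMarkov B₁ A₁, (∀ a, F a = F₁ (F₂ a)) ∧
      FellerMarkov.Implemented.{max w₁ w₂} F := by
  obtain ⟨⟨C₁, φ₁, ν₁⟩, h₁⟩ := h₁
  obtain ⟨⟨C₂, φ₂, ν₂⟩, h₂⟩ := h₂
  -- This is `φ₁ ⊗ id` with target reassociated. Writing `C₂` into `ℂ ⊗ C₂` lets the shuffle act as
  -- associator: `(A₁ ⊗ C₁) ⊗ (ℂ ⊗ C₂) → (A₁ ⊗ ℂ) ⊗ (C₁ ⊗ C₂) → A₁ ⊗ (C₁ ⊗ C₂)`.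
  let ψ : SpatialTensor A₂ C₂ →⋆ₐ[ℂ] SpatialTensor A₁ (SpatialTensor C₁ C₂) :=
    (spatialMap (spatialRid A₁) (StarAlgHom.id ℂ _)).comp
      ((spatialShuffle A₁ C₁ ℂ C₂).comp (spatialMap φ₁ (spatialRight ℂ C₂)))
  have hψ : (slice A₁ (prodState ν₁ ν₂)).comp (starHomCLM ψ) =
      ((slice A₁ ν₁).comp (starHomCLM φ₁)).comp (slice A₂ ν₂) := spatial_clm_ext fun a c => by
    change slice A₁ (prodState ν₁ ν₂) (spatialMap (spatialRid A₁) (StarAlgHom.id ℂ _)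
      (spatialShuffle A₁ C₁ ℂ C₂ (spatialMap φ₁ (spatialRight ℂ C₂) (stmul a c)))) =
        slice A₁ ν₁ (φ₁ (slice A₂ ν₂ (stmul a c)))
    rw [slice_spatialMap _ _ (prodState ν₁ ν₂) _ fun _ => rfl, spatialMap_stmul,
      slice_spatialShuffle, spatialRight_apply, slice_stmul, spatialRid_stmul, slice_stmul,
      map_smul, map_smul, smul_eq_mul, mul_one]
  obtain ⟨F, hF, hI⟩ := exists_implementedBy
    ⟨SpatialTensor C₁ C₂, ψ.comp φ₂, prodState ν₁ ν₂⟩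
  refine ⟨F, fun b => (hF b).trans ?_, hI⟩
  rw [h₂ b, h₁]
  exact DFunLike.congr_fun hψ (φ₂ b)

theorem exists_implemented_prod (F₁ : FellerMarkov B₁ A₁) (F₂ : FellerMarkov B₂ A₂)
    (h₁ : FellerMarkov.Implemented.{w₁} F₁) (h₂ : FellerMarkov.Implemented.{w₂} F₂) :
    ∃ F : FellerMarkov (B₁ × B₂) (A₁ × A₂), (∀ b, F b = (F₁ b.1, F₂ b.2)) ∧
      FellerMarkov.Implemented.{max w₁ w₂} F := by
  obtain ⟨⟨C₁, φ₁, ν₁⟩, h₁⟩ := h₁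
  obtain ⟨⟨C₂, φ₂, ν₂⟩, h₂⟩ := h₂
  -- Both summands must use one common algebra and state; the product state restricts to `ν₁` on `C₁
  -- ⊗ 1` and to `ν₂` on `1 ⊗ C₂`.
  let ψ₁ : B₁ × B₂ →⋆ₐ[ℂ] SpatialTensor A₁ (SpatialTensor C₁ C₂) :=
    ((spatialMap (StarAlgHom.id ℂ A₁) (spatialLeft C₁ C₂)).comp φ₁).comp (StarAlgHom.fst ℂ B₁ B₂)
  let ψ₂ : B₁ × B₂ →⋆ₐ[ℂ] SpatialTensor A₂ (SpatialTensor C₁ C₂) :=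
    ((spatialMap (StarAlgHom.id ℂ A₂) (spatialRight C₁ C₂)).comp φ₂).comp (StarAlgHom.snd ℂ B₁ B₂)
  obtain ⟨F, hF, hI⟩ := exists_implementedBy
    ⟨SpatialTensor C₁ C₂, (spatialProd A₁ A₂ _).comp (ψ₁.prod ψ₂), prodState ν₁ ν₂⟩
  refine ⟨F, fun b => (hF b).trans ?_, hI⟩
  rw [h₁, h₂]
  refine (slice_spatialProd (prodState ν₁ ν₂) (ψ₁ b) (ψ₂ b)).trans (congrArg₂ Prod.mk ?_ ?_)
  · exact slice_spatialMap _ _ ν₁ _ (fun c => by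
      rw [spatialLeft_apply, prodState_stmul, ν₂.2, mul_one]) (φ₁ b.1)
  · exact slice_spatialMap _ _ ν₂ _ (fun c => by
      rw [spatialRight_apply, prodState_stmul, ν₁.2, one_mul]) (φ₂ b.2)

theorem exists_implemented_tensor (F₁ : FellerMarkov B₁ A₁) (F₂ : FellerMarkov B₂ A₂)
    (h₁ : FellerMarkov.Implemented.{w₁} F₁) (h₂ : FellerMarkov.Implemented.{w₂} F₂) :
    ∃ F : FellerMarkov (SpatialTensor B₁ B₂) (SpatialTensor A₁ A₂),
      (∀ b₁ b₂, F (stmul b₁ b₂) = stmul (F₁ b₁) (F₂ b₂)) ∧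
      (∀ G : SpatialTensor B₁ B₂ →L[ℂ] SpatialTensor A₁ A₂,
        (∀ b₁ b₂, G (stmul b₁ b₂) = stmul (F₁ b₁) (F₂ b₂)) → ∀ x, F x = G x) ∧
      FellerMarkov.Implemented.{max w₁ w₂} F := by
  obtain ⟨⟨C₁, φ₁, ν₁⟩, h₁⟩ := h₁
  obtain ⟨⟨C₂, φ₂, ν₂⟩, h₂⟩ := h₂
  let ψ := (spatialShuffle A₁ C₁ A₂ C₂).comp (spatialMap φ₁ φ₂)
  obtain ⟨F, hF, hI⟩ := exists_implementedBy ⟨SpatialTensor C₁ C₂, ψ, prodState ν₁ ν₂⟩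
  -- `F` as a bounded map, so that uniqueness follows from density of the span of elementary
  -- tensors.
  let T := (slice (SpatialTensor A₁ A₂) (prodState ν₁ ν₂)).comp (starHomCLM ψ)
  have hT : ∀ b₁ b₂, T (stmul b₁ b₂) = stmul (F₁ b₁) (F₂ b₂) := fun b₁ b₂ => by
    rw [h₁, h₂]
    change slice (SpatialTensor A₁ A₂) (prodState ν₁ ν₂)
      (spatialShuffle A₁ C₁ A₂ C₂ (spatialMap φ₁ φ₂ (stmul b₁ b₂))) = _
    rw [spatialMap_stmul, slice_spatialShuffle]
    rfl
  exact ⟨F, fun b₁ b₂ => (hF _).trans (hT b₁ b₂), fun G hG x => (hF x).trans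
    (DFunLike.congr_fun (spatial_clm_ext fun b₁ b₂ => (hT b₁ b₂).trans (hG b₁ b₂).symm : T = G) x),
    hI⟩

end Implemented

end QuantumMaps

end

theorem mainTheorem1 :
    -- states are implemented
    (∀ (A : Type u) [CStarAlgebra A] [PartialOrder A] [StarOrderedRing A] (σ : State A),
      ∃ F : FellerMarkov A ℂ, (∀ a, F a = σ.1 a) ∧ FellerMarkov.Implemented.{u} F) ∧
    -- unital star-homomorphisms are implemented
    (∀ (B : Type u₁) [CStarAlgebra B] [PartialOrder B] [StarOrderedRing B]
      (A : Type u₂) [CStarAlgebra A] [PartialOrder A] [StarOrderedRing A] (φ : B →⋆ₐ[ℂ] A),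
      ∃ F : FellerMarkov B A, (∀ b, F b = φ b) ∧ FellerMarkov.Implemented.{w} F) ∧
    -- compositions
    (∀ (A₁ : Type u₁) [CStarAlgebra A₁] [PartialOrder A₁] [StarOrderedRing A₁]
      (A₂ : Type u₂) [CStarAlgebra A₂] [PartialOrder A₂] [StarOrderedRing A₂]
      (A₃ : Type u₃) [CStarAlgebra A₃] [PartialOrder A₃] [StarOrderedRing A₃]
      (F₁ : FellerMarkov A₂ A₁) (F₂ : FellerMarkov A₃ A₂),
      FellerMarkov.Implemented.{w₁} F₁ → FellerMarkov.Implemented.{w₂} F₂ →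
      ∃ F : FellerMarkov A₃ A₁, (∀ a, F a = F₁ (F₂ a)) ∧
        FellerMarkov.Implemented.{max w₁ w₂} F) ∧
    -- direct sums
    (∀ (A₁ : Type u₁) [CStarAlgebra A₁] [PartialOrder A₁] [StarOrderedRing A₁]
      (A₂ : Type u₂) [CStarAlgebra A₂] [PartialOrder A₂] [StarOrderedRing A₂]
      (B₁ : Type u₃) [CStarAlgebra B₁] [PartialOrder B₁] [StarOrderedRing B₁]
      (B₂ : Type u₄) [CStarAlgebra B₂] [PartialOrder B₂] [StarOrderedRing B₂]
      (F₁ : FellerMarkov B₁ A₁) (F₂ : FellerMarkov B₂ A₂),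
      FellerMarkov.Implemented.{w₁} F₁ → FellerMarkov.Implemented.{w₂} F₂ →
      ∃ F : FellerMarkov (B₁ × B₂) (A₁ × A₂), (∀ b, F b = (F₁ b.1, F₂ b.2)) ∧
        FellerMarkov.Implemented.{max w₁ w₂} F) ∧
    -- spatial tensor products; the map is pinned down by its values on elementary tensors
    (∀ (A₁ : Type u₁) [CStarAlgebra A₁] [PartialOrder A₁] [StarOrderedRing A₁]
      (A₂ : Type u₂) [CStarAlgebra A₂] [PartialOrder A₂] [StarOrderedRing A₂]
      (B₁ : Type u₃) [CStarAlgebra B₁] [PartialOrder B₁] [StarOrderedRing B₁]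
      (B₂ : Type u₄) [CStarAlgebra B₂] [PartialOrder B₂] [StarOrderedRing B₂]
      (F₁ : FellerMarkov B₁ A₁) (F₂ : FellerMarkov B₂ A₂),
      FellerMarkov.Implemented.{w₁} F₁ → FellerMarkov.Implemented.{w₂} F₂ →
      ∃ F : FellerMarkov (SpatialTensor B₁ B₂) (SpatialTensor A₁ A₂),
        (∀ b₁ b₂, F (stmul b₁ b₂) = stmul (F₁ b₁) (F₂ b₂)) ∧
        (∀ G : SpatialTensor B₁ B₂ →L[ℂ] SpatialTensor A₁ A₂,
          (∀ b₁ b₂, G (stmul b₁ b₂) = stmul (F₁ b₁) (F₂ b₂)) → ∀ x, F x = G x) ∧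
        FellerMarkov.Implemented.{max w₁ w₂} F) :=
  ⟨fun A _ _ _ => exists_implemented_state A,
    fun _ _ _ _ _ _ _ _ => exists_implemented_starAlgHom,
    fun _ _ _ _ _ _ _ _ _ _ _ _ => exists_implemented_comp,
    fun _ _ _ _ _ _ _ _ _ _ _ _ _ _ _ _ => exists_implemented_prod,
    fun _ _ _ _ _ _ _ _ _ _ _ _ _ _ _ _ => exists_implemented_tensor⟩
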